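/- Let $k\ge 1$ and $\mathbb N=\{1,2,\dots\}$. A *mass-partition with types* is a sequence $\bar{\mathbf x}=((x_1,i_1),(x_2,i_2),\dots)$ with $x_n\ge 0$, $i_n\in\{0,\dots,k\}$ and $\sum_n x_n\le 1$, non-increasing in the lexicographic order, such that $x_n=0\Leftrightarrow i_n=0$ for every $n$. Let $x_0=1-\sum_{n\ge1}x_n$. The space $\bar{\mathcal P}_{\rm m}$ of mass-partitions with types is equipped with the Borel $\sigma$-field of the distance that assigns to $\bar{\mathbf x},\bar{\mathbf x}'$ the Prohorov distance between $\varphi_{\bar{\mathbf x}}$ and $\varphi_{\bar{\mathbf x}'}$, where $\varphi_{\bar{\mathbf x}}=x_0\delta_0+\sum_{n\ge1}x_n\delta_{x_ne_{i_n}}$ and $(e_1,\dots,e_k)$ is the canonical basis of the Euclidean space $\mathbb R^k$. A *partition with types* $\bar\pi$ of a set $B\subseteq\mathbb N$ is a partition of $B$ into non-empty blocks, each of which carries a type in $\{0,\dots,k\}$ that is $0$ if and only if the block is a singleton. The restriction $\bar\pi_{|B'}$ to $B'\subseteq B$ has as blocks the non-empty intersections of the blocks of $\bar\pi$ with $B'$;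 such an intersection keeps the type of the block, except that singletons get the type $0$. The space $\bar{\mathcal P}_{\mathbb N}$ of partitions with types of $\mathbb N$ is equipped with the Borel $\sigma$-field of the distance $d(\bar\pi,\bar\pi')=1/\sup\{n\ge1:\bar\pi_{|[n]}=\bar\pi'_{|[n]}\}$, where $[n]=\{1,\dots,n\}$ and $1/\infty=0$. A bijection $\sigma:\mathbb N\to\mathbb N$ that fixes all but finitely many integers acts on $\bar{\mathcal P}_{\mathbb N}$: the blocks of $\sigma(\bar\pi)$ are the sets $\sigma^{-1}(\beta)$ for the blocks $\beta$ of $\bar\pi$, and $\sigma^{-1}(\beta)$ has the type of $\beta$. A measure on $\bar{\mathcal P}_{\mathbb N}$ is *exchangeable* if it is invariant under the action of all these $\sigma$. We say that $\bar\pi\in\bar{\mathcal P}_{\mathbb N}$ *possesses asymptotic frequencies* if $|\beta|=\lim_{n\to\infty}n^{-1}\mathrm{Card}(\beta\cap[n])$ exists for each of its blocks $\beta$. Then $|\bar\pi|^{\downarrow}\in\bar{\mathcal P}_{\rm m}$ denotes the sequence of the pairs (asymptotic frequency, type) of the blocks with positive asymptotic frequency, ranked in the non-increasing lexicographic order and completed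 by terms $(0,0)$ if there are only finitely many such blocks. For $\bar{\mathbf x}\in\bar{\mathcal P}_{\rm m}$, let $(\xi_1,\tau_1),(\xi_2,\tau_2),\dots$ be i.i.d. with $\mathbb P((\xi_1,\tau_1)=(n,i_n))=x_n$ for $n\ge1$ and $\mathbb P((\xi_1,\tau_1)=(0,0))=x_0$. The *paintbox* $\rho_{\bar{\mathbf x}}$ is the law on $\bar{\mathcal P}_{\mathbb N}$ of the random partition with types in which two distinct integers $\ell,m$ are in the same block if and only if $\xi_\ell=\xi_m\ge1$, the type of that block being then $\tau_\ell=\tau_m$. **Theorem.** The map $\bar{\mathbf x}\mapsto\rho_{\bar{\mathbf x}}$ is measurable, and the following holds. (i) Let $\rho$ be an exchangeable probability measure on $\bar{\mathcal P}_{\mathbb N}$. Then $\rho$-almost every $\bar\pi$ possesses asymptotic frequencies, $\bar\pi\mapsto|\bar\pi|^{\downarrow}$ is $\rho$-almost everywhere well-defined and $\rho$-almost everywhere equal to a measurable map, and if $\varrho$ denotes the distribution of $|\bar\pi|^{\downarrow}$ under $\rho$, then $$\rho(\mathrm d\bar\pi)=\int_{\bar{\mathcal P}_{\rm m}}\rho_{\bar{\mathbf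 x}}(\mathrm d\bar\pi)\,\varrho(\mathrm d\bar{\mathbf x}).\qquad(*)$$ (ii) Conversely, for every probability measure $\varrho$ on $\bar{\mathcal P}_{\rm m}$, the right-hand side of $(*)$ defines an exchangeable probability measure on $\bar{\mathcal P}_{\mathbb N}$. -/

import Mathlib

open MeasureTheory Filter Topology
open scoped ENNReal

noncomputable section

/-- A mass-partition with types in `{0, …, k}`: a sequence `((x₁, i₁), (x₂, i₂), …)`, with `xₙ ≥ 0`
and `∑ xₙ ≤ 1`, non-increasing in the lexicographic order, and with `xₙ = 0 ↔ iₙ = 0`.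
The term of rank `n + 1` is stored at the index `n`. -/
structure MassPartition (k : ℕ) where
  mass : ℕ → ℝ
  type : ℕ → Fin (k + 1)
  nonneg : ∀ n, 0 ≤ mass n
  mass_anti : ∀ n, mass (n + 1) ≤ mass n
  summable : Summable mass
  tsum_le_one : ∑' n, mass n ≤ 1
  mass_eq_zero_iff : ∀ n, mass n = 0 ↔ type n = 0
  type_anti : ∀ n, mass n = mass (n + 1) → type (n + 1) ≤ type n

namespace MassPartition

variable {k : ℕ}

/-- The pure dust `((0, 0), (0, 0), …)`. -/
def pureDust (k : ℕ) : MassPartition k where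
  mass := fun _ => 0
  type := fun _ => 0
  nonneg := fun _ => le_rfl
  mass_anti := fun _ => le_rfl
  summable := summable_zero
  tsum_le_one := by simp
  mass_eq_zero_iff := fun _ => by simp
  type_anti := fun _ _ => le_rfl

/-- The mass of dust `x₀ = 1 - ∑ xₙ`. -/
def dust (x : MassPartition k) : ℝ := 1 - ∑' n, x.mass n

theorem mass_total (x : MassPartition k) :
    ENNReal.ofReal x.dust + ∑' n, ENNReal.ofReal (x.mass n) = 1 := by
  rw [dust, ← ENNReal.ofReal_tsum_of_nonneg x.nonneg x.summable,
    ← ENNReal.ofReal_add (sub_nonneg.2 x.tsum_le_one) (tsum_nonneg x.nonneg)]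
  simp

/-- The vector `e_i` of the canonical basis of `ℝᵏ` for a type `i ≥ 1`. (For `i = 0` the value
is irrelevant, since it is only ever multiplied by a zero mass.) -/
def axis (i : Fin (k + 1)) : EuclideanSpace ℝ (Fin k) :=
  Fin.cases 0 (fun j => EuclideanSpace.single j (1 : ℝ)) i

/-- The measure `φ_x = x₀ δ_0 + ∑ xₙ δ_{xₙ e_{iₙ}}`. -/
def phi (x : MassPartition k) : Measure (EuclideanSpace ℝ (Fin k)) :=
  ENNReal.ofReal x.dust • Measure.dirac 0 +
    Measure.sum (fun n => ENNReal.ofReal (x.mass n) • Measure.dirac (x.mass n • axis (x.type n)))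

instance (x : MassPartition k) : IsProbabilityMeasure x.phi :=
  ⟨by simpa [phi] using x.mass_total⟩

/-- The measure `φ_x` as a probability measure. -/
def phiProb (x : MassPartition k) : ProbabilityMeasure (EuclideanSpace ℝ (Fin k)) :=
  ⟨x.phi, inferInstance⟩

/-- The distance between mass-partitions with types is the Lévy–Prokhorov distance between the
associated probability measures `φ_x`. -/
instance : PseudoMetricSpace (MassPartition k) :=
  PseudoMetricSpace.induced
    (fun x => LevyProkhorov.ofMeasure x.phiProb) inferInstance

instance : MeasurableSpace (MassPartition k) := borel _

instance : BorelSpace (MassPartition k) := ⟨rfl⟩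

/-- The law of the pair `(ξ, τ)` with `ℙ((ξ, τ) = (n, iₙ)) = xₙ` for `n ≥ 1` and
`ℙ((ξ, τ) = (0, 0)) = x₀`. -/
def colourLaw (x : MassPartition k) : Measure (ℕ × Fin (k + 1)) :=
  ENNReal.ofReal x.dust • Measure.dirac (0, 0) +
    Measure.sum (fun n => ENNReal.ofReal (x.mass n) • Measure.dirac (n + 1, x.type n))

instance (x : MassPartition k) : IsProbabilityMeasure x.colourLaw :=
  ⟨by simpa [colourLaw] using x.mass_total⟩

end MassPartition

/-- A partition with types in `{0, …, k}` of a set `ι`: an equivalence relation whose classes are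
the (non-empty) blocks, together with a type for every block, which is `0` exactly when the block
is a singleton. Here `type a` is the type of the block that contains `a`.
Partitions of `{1, 2, …}` are represented by `ι = ℕ`, with the integer `n + 1` relabelled `n`. -/
@[ext]
structure TypedPartition (k : ℕ) (ι : Type*) where
  rel : Setoid ι
  type : ι → Fin (k + 1)
  type_congr : ∀ a b, rel a b → type a = type b
  type_eq_zero_iff : ∀ a, type a = 0 ↔ ∀ b, rel a b → b = a

namespace TypedPartition

variable {k : ℕ} {ι : Type*}

open Classical in
/-- The restriction of a partition with types to `B`: the blocks are the non-empty intersections of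
the blocks with `B`; such an intersection keeps its type unless it is a singleton, in which case
its type becomes `0`. -/
def restrict (π : TypedPartition k ι) (B : Set ι) : TypedPartition k B where
  rel := π.rel.comap Subtype.val
  type := fun a => if ∀ b : B, π.rel a b → b = a then 0 else π.type a
  type_congr := by
    intro a b hab
    have hab' : π.rel a b := hab
    by_cases h : a = b
    · rw [h]
    · rw [if_neg, if_neg, π.type_congr _ _ hab']
      · exact fun H => h (H a (π.rel.symm' hab'))
      · exact fun H => h (H b hab').symm
  type_eq_zero_iff := by
    intro a
    constructor
    · intro h b hab
      by_contra hne
      rw [if_neg (fun H => hne (H b hab)), π.type_eq_zero_iff] at h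
      exact hne (Subtype.ext (h b hab))
    · intro h
      exact if_pos h

theorem restrict_eq_iff (π π' : TypedPartition k ι) (B : Set ι) :
    π.restrict B = π'.restrict B ↔ ∀ a ∈ B, ∀ b ∈ B,
      (π.rel a b ↔ π'.rel a b) ∧ (π.rel a b → a ≠ b → π.type a = π'.type a) := by
  constructor
  · intro h a ha b hb
    have h1 : ∀ c d : B, π.rel c d ↔ π'.rel c d := fun c d =>
      iff_of_eq (congrArg (fun p : TypedPartition k B => p.rel c d) h)
    refine ⟨h1 ⟨a, ha⟩ ⟨b, hb⟩, fun hab hne => ?_⟩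
    have h2 := congrArg (fun p : TypedPartition k B => p.type ⟨a, ha⟩) h
    simp only [restrict] at h2
    rw [if_neg, if_neg] at h2
    · exact h2
    · exact fun H => hne (congrArg Subtype.val (H ⟨b, hb⟩ ((h1 ⟨a, ha⟩ ⟨b, hb⟩).1 hab))).symm
    · exact fun H => hne (congrArg Subtype.val (H ⟨b, hb⟩ hab)).symm
  · intro h
    apply TypedPartition.ext
    · ext a b
      exact (h a a.2 b b.2).1
    · funext a
      simp only [restrict]
      have e : (∀ b : B, π.rel a b → b = a) ↔ ∀ b : B, π'.rel a b → b = a :=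
        forall_congr' fun b => by rw [(h a a.2 b b.2).1]
      by_cases H : ∀ b : B, π.rel a b → b = a
      · rw [if_pos H, if_pos (e.1 H)]
      · rw [if_neg H, if_neg (fun H' => H (e.2 H'))]
        push Not at H
        obtain ⟨b, hab, hne⟩ := H
        exact (h a a.2 b b.2).2 hab (fun hh => hne (Subtype.ext hh.symm))

/-- The positive integers `n` such that `π` and `π'` have the same restriction to
`[n] = {1, …, n}`. -/
def agreeSet (π π' : TypedPartition k ℕ) : Set ℕ :=
  {n | 0 < n ∧ π.restrict (Set.Iio n) = π'.restrict (Set.Iio n)}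

theorem one_mem_agreeSet (π π' : TypedPartition k ℕ) : 1 ∈ agreeSet π π' := by
  refine ⟨one_pos, (restrict_eq_iff _ _ _).2 fun a ha b hb => ?_⟩
  have ha0 : a = 0 := by simpa using ha
  have hb0 : b = 0 := by simpa using hb
  subst ha0 hb0
  exact ⟨iff_of_true (π.rel.refl' 0) (π'.rel.refl' 0), fun _ h => absurd rfl h⟩

instance (π π' : TypedPartition k ℕ) : Nonempty (agreeSet π π') := ⟨⟨1, one_mem_agreeSet π π'⟩⟩

theorem agreeSet_anti {π π' : TypedPartition k ℕ} {m n : ℕ} (hm : 0 < m) (hmn : m ≤ n)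
    (hn : n ∈ agreeSet π π') : m ∈ agreeSet π π' :=
  ⟨hm, (restrict_eq_iff _ _ _).2 fun a ha b hb => (restrict_eq_iff _ _ _).1 hn.2
    a (lt_of_lt_of_le ha hmn) b (lt_of_lt_of_le hb hmn)⟩

theorem eq_of_forall_mem_agreeSet {π π' : TypedPartition k ℕ}
    (h : ∀ n, 0 < n → n ∈ agreeSet π π') : π = π' := by
  have key : ∀ a b, (π.rel a b ↔ π'.rel a b) ∧ (π.rel a b → a ≠ b → π.type a = π'.type a) :=
    fun a b => (restrict_eq_iff _ _ _).1 (h (a + b + 1) (by omega)).2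
      a (Set.mem_Iio.2 (by omega)) b (Set.mem_Iio.2 (by omega))
  apply TypedPartition.ext
  · ext a b
    exact (key a b).1
  · funext a
    by_cases H : ∀ b, π.rel a b → b = a
    · rw [(π.type_eq_zero_iff a).2 H,
        (π'.type_eq_zero_iff a).2 (fun b hb => H b ((key a b).1.2 hb))]
    · push Not at H
      obtain ⟨b, hab, hne⟩ := H
      exact (key a b).2 hab hne.symm

/-- The distance `d(π, π') = 1 / sup {n ≥ 1 : π and π' have the same restriction to [n]}`,
with `1 / ∞ = 0`, written as the infimum of the numbers `1 / n`. -/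
instance : MetricSpace (TypedPartition k ℕ) where
  dist π π' := ⨅ n : agreeSet π π', 1 / (n : ℝ)
  dist_self π := by
    apply le_antisymm
    · refine le_of_forall_pos_le_add fun ε hε => ?_
      obtain ⟨n, hn⟩ := exists_nat_one_div_lt hε
      have : n + 1 ∈ agreeSet π π := ⟨n.succ_pos, rfl⟩
      refine (ciInf_le ⟨0, ?_⟩ (⟨n + 1, this⟩ : agreeSet π π)).trans ?_
      · rintro _ ⟨m, rfl⟩
        positivity
      · push_cast
        linarith
    · exact Real.iInf_nonneg fun n => by positivity
  dist_comm π π' := by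
    have : agreeSet π π' = agreeSet π' π := by
      ext n
      simp only [agreeSet, Set.mem_ofPred_eq, eq_comm]
    rw [this]
  dist_triangle π π' π'' := by
    refine le_ciInf_add_ciInf fun m n => ?_
    have hmem : min (m : ℕ) n ∈ agreeSet π π'' := by
      have hp : 0 < min (m : ℕ) n := lt_min m.2.1 n.2.1
      exact ⟨hp, (agreeSet_anti hp (min_le_left _ _) m.2).2.trans
        (agreeSet_anti hp (min_le_right _ _) n.2).2⟩
    refine (ciInf_le ⟨0, ?_⟩ (⟨_, hmem⟩ : agreeSet π π'')).trans ?_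
    · rintro _ ⟨m, rfl⟩
      positivity
    · have h1 : 0 ≤ 1 / ((m : ℕ) : ℝ) := by positivity
      have h2 : 0 ≤ 1 / ((n : ℕ) : ℝ) := by positivity
      rcases min_choice (m : ℕ) n with h | h <;> simp only [h] <;> linarith
  eq_of_dist_eq_zero := by
    intro π π' h
    refine eq_of_forall_mem_agreeSet fun n hn => ?_
    by_contra hnot
    have hlt : ∀ m : agreeSet π π', 1 / (n : ℝ) ≤ 1 / (m : ℝ) := by
      intro m
      have hm : (m : ℕ) ≤ n := by
        by_contra hh
        exact hnot (agreeSet_anti hn (not_le.1 hh).le m.2)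
      exact one_div_le_one_div_of_le (by exact_mod_cast m.2.1) (by exact_mod_cast hm)
    have h1 : 1 / (n : ℝ) ≤ 0 := (le_ciInf hlt).trans h.le
    have h2 : 0 < 1 / (n : ℝ) := by positivity
    linarith

instance : MeasurableSpace (TypedPartition k ℕ) := borel _

instance : BorelSpace (TypedPartition k ℕ) := ⟨rfl⟩

/-- The action of a permutation: the blocks of `σ(π)` are the sets `σ⁻¹(B)` for the blocks `B`
of `π`, and `σ⁻¹(B)` receives the type of `B`. -/
def permute (σ : Equiv.Perm ι) (π : TypedPartition k ι) : TypedPartition k ι where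
  rel := π.rel.comap σ
  type := fun a => π.type (σ a)
  type_congr := fun a b h => π.type_congr (σ a) (σ b) h
  type_eq_zero_iff := by
    intro a
    rw [π.type_eq_zero_iff]
    constructor
    · exact fun h b hb => σ.injective (h (σ b) hb)
    · intro h b hb
      have : π.rel (σ a) (σ (σ.symm b)) := by simpa using hb
      rw [← h (σ.symm b) this, σ.apply_symm_apply]

/-- A measure is exchangeable if it is invariant under the action of finite permutations. -/
def Exchangeable (μ : Measure (TypedPartition k ℕ)) : Prop :=
  ∀ σ : Equiv.Perm ℕ, {n | σ n ≠ n}.Finite → μ.map (permute σ) = μ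

/-- The block that contains `a`. -/
def block (π : TypedPartition k ι) (a : ι) : Set ι := {b | π.rel a b}

/-- The collection of all (non-empty) blocks. -/
def blocks (π : TypedPartition k ι) : Set (Set ι) := Set.range π.block

end TypedPartition

/-- The proportion `Card(B ∩ [n]) / n`. -/
def proportion (B : Set ℕ) (n : ℕ) : ℝ := ((B ∩ Set.Iio n).ncard : ℝ) / n

/-- The set `B` possesses an asymptotic frequency. -/
def HasFrequency (B : Set ℕ) : Prop := ∃ f : ℝ, Tendsto (proportion B) atTop (𝓝 f)

/-- The asymptotic frequency `|B|` (meaningful only when it exists). -/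
def frequency (B : Set ℕ) : ℝ := limUnder atTop (proportion B)

namespace TypedPartition

variable {k : ℕ}

/-- All the blocks possess asymptotic frequencies. -/
def HasFrequencies (π : TypedPartition k ℕ) : Prop := ∀ B ∈ π.blocks, HasFrequency B

/-- `x` is the sequence of the asymptotic frequencies and types of the blocks of `π`, ranked in the
non-increasing lexicographic order: the positive terms of `x` (which are ranked, by the definition
of a mass-partition with types) are exactly the pairs (frequency, type) of the blocks with positive
frequency, each block being listed once, and the other terms are `(0, 0)`. -/
def IsRanking (π : TypedPartition k ℕ) (x : MassPartition k) : Prop :=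
  ∃ e : {B : Set ℕ // B ∈ π.blocks ∧ 0 < frequency B} ≃ {n : ℕ // 0 < x.mass n},
    ∀ B, x.mass (e B) = frequency B.1 ∧ ∀ a ∈ B.1, x.type (e B) = π.type a

open Classical in
/-- The ranked sequence `|π|↓` of a partition with types that has asymptotic frequencies;
the value for other partitions is arbitrary. -/
def ranked (π : TypedPartition k ℕ) : MassPartition k :=
  if h : π.HasFrequencies ∧ ∃ x, π.IsRanking x then h.2.choose else MassPartition.pureDust k

open Classical in
/-- The partition with types built from the sequence `(ξ₁, τ₁), (ξ₂, τ₂), …`: two distinct integers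
`ℓ, m` are in the same block if and only if `ξ_ℓ = ξ_m ≥ 1`, and the type of that block is
`τ_ℓ = τ_m`; a singleton has type `0`. The conditions `τ_ℓ = τ_m ≠ 0` in the definition hold
automatically, almost surely, when `ξ_ℓ = ξ_m ≥ 1`; they make the map well-defined on all
sequences. -/
def ofColours (ω : ℕ → ℕ × Fin (k + 1)) : TypedPartition k ℕ where
  rel :=
    { r := fun l m => l = m ∨ (ω l = ω m ∧ 1 ≤ (ω m).1 ∧ (ω m).2 ≠ 0)
      iseqv :=
        { refl := fun _ => Or.inl rfl
          symm := by
            rintro l m (h | ⟨h, h1, h2⟩)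
            · exact Or.inl h.symm
            · exact Or.inr ⟨h.symm, h ▸ h1, h ▸ h2⟩
          trans := by
            rintro l m p (rfl | ⟨h, h1, h2⟩) (rfl | ⟨h', h1', h2'⟩)
            · exact Or.inl rfl
            · exact Or.inr ⟨h', h1', h2'⟩
            · exact Or.inr ⟨h, h1, h2⟩
            · exact Or.inr ⟨h.trans h', h1', h2'⟩ } }
  type := fun l =>
    if ∃ m, m ≠ l ∧ ω l = ω m ∧ 1 ≤ (ω m).1 ∧ (ω m).2 ≠ 0 then (ω l).2 else 0
  type_congr := by
    rintro l m (rfl | ⟨h, h1, h2⟩)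
    · rfl
    · by_cases hlm : l = m
      · rw [hlm]
      · rw [if_pos ⟨m, Ne.symm hlm, h, h1, h2⟩, if_pos ⟨l, hlm, h.symm, h ▸ h1, h ▸ h2⟩, h]
  type_eq_zero_iff := by
    intro l
    constructor
    · rintro h0 m (h | ⟨h, h1, h2⟩)
      · exact h.symm
      · by_contra hne
        rw [if_pos ⟨m, hne, h, h1, h2⟩, h] at h0
        exact h2 h0
    · intro H
      exact if_neg fun ⟨m, hne, h, h1, h2⟩ => hne (H m (Or.inr ⟨h, h1, h2⟩))

end TypedPartition

/-- The paintbox `ρ_x` based on `x`: the law of the partition with types built from a sequence of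
i.i.d. copies of `(ξ, τ)`. -/
def paintbox {k : ℕ} (x : MassPartition k) : Measure (TypedPartition k ℕ) :=
  (Measure.infinitePi fun _ : ℕ => x.colourLaw).map TypedPartition.ofColours

end

/-! A law on partitions with types is determined by the probabilities of the events that prescribe
finitely many coalescences and the types of the blocks concerned: these events form a π-system that
generates the Borel σ-field. A non-empty such event says that each set `A` of a finite disjoint
family, with at least two points each, lies in one block of type `θ A ≠ 0`. Under a paintbox,
independence gives it the probability `∏ A, x.powerSum A.card (θ A)` (`paintbox_iInter_sameBlock`).
Power sums of order at least 2 are integrals of bounded continuous functions against `φ_x`, hence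
continuous in `x`, so the paintbox is measurable. Part (ii) follows, since an i.i.d. sequence is
exchangeable.

For (i), neither de Finetti's theorem nor conditioning is used. Exchangeability gives the second
moments of the proportions of a block up to `O(1/n)`, whence almost sure convergence along fourth
powers, and everywhere by monotonicity (`ae_hasFrequency_block`). The main tool is a replacement
principle (`integral_mul_eq_of_tendsto_mean`): if `Z` is invariant under the finite permutations
that fix `D`, and `a ∉ D`, then inside `∫ Z * X a` the factor `X a` may be replaced by the limit of
the means of the `X i`. Used repeatedly, it turns "`a` is in the block of `r`" into the frequency of
that block, and then "`r` has type `t`, times the frequency to the power `m - 1`" into the sum of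
the `m`-th powers of the frequencies of the blocks of type `t`. Thus the probability of a prescribed
event is the expectation of a product of power sums of `|π|↓`, which is also its probability under
the mixture of paintboxes. Finally, `|π|↓` is almost everywhere a limit of maps that factor
measurably through countable sets, hence almost everywhere equal to a measurable map. -/

noncomputable section

/-! ### The generating π-system of prescribed coalescences -/

namespace TypedPartition

variable {k : ℕ}

/-- The points whose class for `s` is not a singleton. -/
def nontrivialPoints (s : Setoid ℕ) : Set ℕ := {a | ∃ b, b ≠ a ∧ s a b}

/-- The partitions coarser than `s` whose types on the non-trivial classes of `s` are given
by `τ`. -/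
def pattern (s : Setoid ℕ) (τ : ℕ → Fin (k + 1)) : Set (TypedPartition k ℕ) :=
  {π | ∀ a b, a ≠ b → s a b → π.rel a b ∧ π.type a = τ a}

/-- The events that prescribe finitely many coalescences and types. -/
def patternEvents (k : ℕ) : Set (Set (TypedPartition k ℕ)) :=
  {E | ∃ (s : Setoid ℕ) (τ : ℕ → Fin (k + 1)), (nontrivialPoints s).Finite ∧ E = pattern s τ}

/-- The equivalence relation which identifies the points of `T`. -/
def collapse (T : Set ℕ) : Setoid ℕ where
  r a b := a = b ∨ (a ∈ T ∧ b ∈ T)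
  iseqv :=
    { refl := fun _ => Or.inl rfl
      symm := by
        rintro a b (h | h)
        · exact Or.inl h.symm
        · exact Or.inr ⟨h.2, h.1⟩
      trans := by
        rintro a b c (rfl | h) (rfl | h')
        · exact Or.inl rfl
        · exact Or.inr h'
        · exact Or.inr h
        · exact Or.inr ⟨h.1, h'.2⟩ }

theorem nontrivialPoints_collapse (T : Set ℕ) : nontrivialPoints (collapse T) ⊆ T := by
  rintro a ⟨b, hne, h | h⟩
  · exact absurd h.symm hne
  · exact h.1

theorem le_collapse_nontrivialPoints {s : Setoid ℕ} {T : Set ℕ} (h : nontrivialPoints s ⊆ T) :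
    s ≤ collapse T := by
  intro a b hab
  by_cases hne : a = b
  · exact Or.inl hne
  · exact Or.inr ⟨h ⟨b, Ne.symm hne, hab⟩, h ⟨a, hne, s.symm' hab⟩⟩

theorem nontrivialPoints_sup (s s' : Setoid ℕ) :
    nontrivialPoints (s ⊔ s') ⊆ nontrivialPoints s ∪ nontrivialPoints s' := by
  rintro a ⟨b, hne, hab⟩
  have : s ⊔ s' ≤ collapse (nontrivialPoints s ∪ nontrivialPoints s') :=
    sup_le (le_collapse_nontrivialPoints Set.subset_union_left)
      (le_collapse_nontrivialPoints Set.subset_union_right)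
  rcases this hab with h | h
  · exact absurd h.symm hne
  · exact h.1

theorem le_rel_of_mem_pattern {s : Setoid ℕ} {τ : ℕ → Fin (k + 1)} {π : TypedPartition k ℕ}
    (h : π ∈ pattern s τ) : s ≤ π.rel := by
  intro a b hab
  by_cases hne : a = b
  · rw [hne]
  · exact (h a b hne hab).1

/-- The two prescriptions amount to one on `s ⊔ s'`. Prescribed types may conflict, so they are read
off from a partition `π₀` in the intersection; a non-trivial point of `s ⊔ s'` is already
non-trivial for `s` or `s'`, which forces its type. -/
theorem isPiSystem_patternEvents (k : ℕ) : IsPiSystem (patternEvents k) := by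
  rintro _ ⟨s, τ, hs, rfl⟩ _ ⟨s', τ', hs', rfl⟩ ⟨π₀, h₀, h₀'⟩
  refine ⟨s ⊔ s', π₀.type, (hs.union hs').subset (nontrivialPoints_sup s s'), ?_⟩
  ext π
  constructor
  · rintro ⟨h, h'⟩ a b hne hab
    refine ⟨sup_le (le_rel_of_mem_pattern h) (le_rel_of_mem_pattern h') hab, ?_⟩
    rcases nontrivialPoints_sup s s' ⟨b, hne.symm, hab⟩ with ⟨c, hc, hac⟩ | ⟨c, hc, hac⟩
    · rw [(h a c hc.symm hac).2, (h₀ a c hc.symm hac).2]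
    · rw [(h' a c hc.symm hac).2, (h₀' a c hc.symm hac).2]
  · intro h
    refine ⟨fun a b hne hab => ?_, fun a b hne hab => ?_⟩
    · have := h a b hne ((le_sup_left : s ≤ s ⊔ s') hab)
      exact ⟨this.1, this.2.trans (h₀ a b hne hab).2⟩
    · have := h a b hne ((le_sup_right : s' ≤ s ⊔ s') hab)
      exact ⟨this.1, this.2.trans (h₀' a b hne hab).2⟩

theorem pattern_collapse_pair {a b : ℕ} (hab : a ≠ b) (t : Fin (k + 1)) :
    pattern (collapse {a, b}) (fun _ => t) = {π | π.rel a b ∧ π.type a = t} := by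
  ext π
  constructor
  · exact fun h => h a b hab (Or.inr ⟨by simp, by simp⟩)
  · rintro ⟨h, ht⟩ c d hne (hcd | ⟨hc, hd⟩)
    · exact absurd hcd hne
    · have hb : π.type b = t := (π.type_congr _ _ h).symm.trans ht
      rcases hc with rfl | rfl <;> rcases hd with rfl | rfl
      · exact absurd rfl hne
      · exact ⟨h, ht⟩
      · exact ⟨π.rel.symm' h, hb⟩
      · exact absurd rfl hne

theorem pair_mem_patternEvents {a b : ℕ} (hab : a ≠ b) (t : Fin (k + 1)) :
    {π : TypedPartition k ℕ | π.rel a b ∧ π.type a = t} ∈ patternEvents k :=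
  ⟨collapse {a, b}, fun _ => t, Set.Finite.subset (by simp) (nontrivialPoints_collapse _),
    (pattern_collapse_pair hab t).symm⟩

instance finite_typedPartition {ι : Type*} [Finite ι] : Finite (TypedPartition k ι) := by
  refine Finite.of_injective
    (fun π : TypedPartition k ι => ((fun a b => π.rel a b : ι → ι → Prop), π.type)) ?_
  intro π π' h
  simp only [Prod.mk.injEq] at h
  refine TypedPartition.ext ?_ h.2
  ext a b
  exact iff_of_eq (congrFun (congrFun h.1 a) b)

theorem measurableSet_generateFrom_rel (a b : ℕ) :
    MeasurableSet[MeasurableSpace.generateFrom (patternEvents k)]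
      {π : TypedPartition k ℕ | π.rel a b} := by
  by_cases hab : a = b
  · have : {π : TypedPartition k ℕ | π.rel a b} = Set.univ := by
      ext π
      simp only [hab, Set.mem_ofPred_eq, Set.mem_univ, iff_true]
      exact π.rel.refl' b
    rw [this]
    exact MeasurableSet.univ
  · have : {π : TypedPartition k ℕ | π.rel a b} = ⋃ t, {π | π.rel a b ∧ π.type a = t} := by
      ext π
      simp
    rw [this]
    exact MeasurableSet.iUnion fun t =>
      MeasurableSpace.measurableSet_generateFrom (pair_mem_patternEvents hab t)

theorem measurableSet_generateFrom_restrict (n : ℕ) (γ : TypedPartition k ℕ) :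
    MeasurableSet[MeasurableSpace.generateFrom (patternEvents k)]
      {π : TypedPartition k ℕ | π.restrict (Set.Iio n) = γ.restrict (Set.Iio n)} := by
  have : {π : TypedPartition k ℕ | π.restrict (Set.Iio n) = γ.restrict (Set.Iio n)} =
      ⋂ a ∈ Set.Iio n, ⋂ b ∈ Set.Iio n,
        {π | (π.rel a b ↔ γ.rel a b) ∧ (π.rel a b → a ≠ b → π.type a = γ.type a)} := by
    ext π
    simp only [Set.mem_ofPred_eq, restrict_eq_iff, Set.mem_iInter]
  rw [this]
  refine MeasurableSet.biInter (Set.to_countable _) fun a _ =>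
    MeasurableSet.biInter (Set.to_countable _) fun b _ => ?_
  have hr := measurableSet_generateFrom_rel (k := k) a b
  by_cases hab : a = b
  · convert @MeasurableSet.univ _ (MeasurableSpace.generateFrom (patternEvents k)) using 1
    ext π
    subst hab
    simp only [ne_eq, not_true_eq_false, false_imp_iff, imp_true_iff, and_true, Set.mem_ofPred_eq,
      Set.mem_univ, iff_true]
    exact iff_of_true (π.rel.refl' a) (γ.rel.refl' a)
  by_cases hγ : γ.rel a b
  · convert MeasurableSpace.measurableSet_generateFrom
      (pair_mem_patternEvents (k := k) hab (γ.type a)) using 1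
    ext π
    simp only [Set.mem_ofPred_eq]
    tauto
  · convert hr.compl using 1
    ext π
    simp only [Set.mem_ofPred_eq, Set.mem_compl_iff]
    tauto

theorem exists_restrict_subset_of_isOpen {U : Set (TypedPartition k ℕ)} (hU : IsOpen U)
    {γ : TypedPartition k ℕ} (hγ : γ ∈ U) :
    ∃ n, {π : TypedPartition k ℕ | π.restrict (Set.Iio n) = γ.restrict (Set.Iio n)} ⊆ U := by
  obtain ⟨ε, hε, hball⟩ := Metric.isOpen_iff.1 hU γ hγ
  obtain ⟨n, hn⟩ := exists_nat_one_div_lt hε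
  refine ⟨n + 1, fun π hπ => hball ?_⟩
  have hmem : n + 1 ∈ agreeSet π γ := ⟨n.succ_pos, hπ⟩
  change (⨅ n : agreeSet π γ, 1 / (n : ℝ)) < ε
  refine lt_of_le_of_lt (ciInf_le ⟨0, ?_⟩ (⟨n + 1, hmem⟩ : agreeSet π γ)) ?_
  · rintro _ ⟨m, rfl⟩
    positivity
  · push_cast
    exact hn

/-- Partitions this close agree on an initial segment that contains `a` and `b`. With `a = b` this
would fail: restriction erases the type of a block that meets the segment in one point only. -/
theorem isOpen_rel_type {a b : ℕ} (t : Fin (k + 1)) (hab : a ≠ b) :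
    IsOpen {π : TypedPartition k ℕ | π.rel a b ∧ π.type a = t} := by
  rw [Metric.isOpen_iff]
  rintro γ ⟨hγ, rfl⟩
  refine ⟨1 / ((a + b + 1 : ℕ) : ℝ), by positivity, fun π hπ => ?_⟩
  have hπ' : (⨅ n : agreeSet π γ, 1 / (n : ℝ)) < 1 / ((a + b + 1 : ℕ) : ℝ) := hπ
  obtain ⟨n, hn⟩ := exists_lt_of_ciInf_lt hπ'
  have hn' : a + b + 1 < (n : ℕ) := by
    have := (one_div_lt_one_div (by exact_mod_cast n.2.1) (by positivity)).1 hn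
    exact_mod_cast this
  have key := (restrict_eq_iff _ _ _).1 n.2.2 a (Set.mem_Iio.2 (by omega)) b
    (Set.mem_Iio.2 (by omega))
  exact ⟨key.1.2 hγ, key.2 (key.1.2 hγ) hab⟩

theorem measurableSet_pair {a b : ℕ} (t : Fin (k + 1)) (hab : a ≠ b) :
    MeasurableSet {π : TypedPartition k ℕ | π.rel a b ∧ π.type a = t} :=
  (isOpen_rel_type t hab).measurableSet

theorem measurableSet_pattern {s : Setoid ℕ} {τ : ℕ → Fin (k + 1)} :
    MeasurableSet (pattern s τ) := by
  have : pattern s τ = ⋂ a, ⋂ b, ⋂ (_ : a ≠ b), ⋂ (_ : s a b),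
      {π : TypedPartition k ℕ | π.rel a b ∧ π.type a = τ a} := by
    ext π
    simp [pattern]
  rw [this]
  exact MeasurableSet.iInter fun a => MeasurableSet.iInter fun b => MeasurableSet.iInter fun hab =>
    MeasurableSet.iInter fun _ => measurableSet_pair _ hab

theorem borel_eq_generateFrom_patternEvents (k : ℕ) :
    TypedPartition.instMeasurableSpaceNat =
      MeasurableSpace.generateFrom (patternEvents k) := by
  apply le_antisymm
  · refine MeasurableSpace.generateFrom_le fun U hU => ?_
    have hU' : IsOpen U := hU
    -- The union is countable, because a finite set has finitely many partitions with types.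
    have : U = ⋃ n : ℕ, ⋃ q : {q : TypedPartition k (Set.Iio n) //
        {π : TypedPartition k ℕ | π.restrict (Set.Iio n) = q} ⊆ U},
        {π : TypedPartition k ℕ | π.restrict (Set.Iio n) = q.1} := by
      ext γ
      simp only [Set.mem_iUnion, Set.mem_ofPred_eq]
      constructor
      · intro hγ
        obtain ⟨n, hn⟩ := exists_restrict_subset_of_isOpen hU' hγ
        exact ⟨n, ⟨_, hn⟩, rfl⟩
      · rintro ⟨n, q, hq⟩
        exact q.2 hq
    rw [this]
    refine MeasurableSet.iUnion fun n => MeasurableSet.iUnion fun q => ?_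
    by_cases hq : ∃ γ : TypedPartition k ℕ, γ.restrict (Set.Iio n) = q.1
    · obtain ⟨γ, hγ⟩ := hq
      rw [← hγ]
      exact measurableSet_generateFrom_restrict n γ
    · convert @MeasurableSet.empty _ (MeasurableSpace.generateFrom (patternEvents k)) using 1
      ext π
      simp only [Set.mem_ofPred_eq, Set.mem_empty_iff_false, iff_false]
      exact fun h => hq ⟨π, h⟩
  · refine MeasurableSpace.generateFrom_le ?_
    rintro _ ⟨s, τ, -, rfl⟩
    exact measurableSet_pattern

theorem measurableSet_rel (a b : ℕ) : MeasurableSet {π : TypedPartition k ℕ | π.rel a b} := by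
  rw [borel_eq_generateFrom_patternEvents k]
  exact measurableSet_generateFrom_rel a b

/-- A non-zero type is witnessed by a second point of the block, which gives a countable union of
measurable events; type `0` is what remains. -/
theorem measurableSet_type_eq (a : ℕ) (t : Fin (k + 1)) :
    MeasurableSet {π : TypedPartition k ℕ | π.type a = t} := by
  have key : ∀ t : Fin (k + 1), t ≠ 0 → MeasurableSet {π : TypedPartition k ℕ | π.type a = t} := by
    intro t ht
    have : {π : TypedPartition k ℕ | π.type a = t} =
        ⋃ b, ⋃ (_ : a ≠ b), {π | π.rel a b ∧ π.type a = t} := by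
      ext π
      simp only [Set.mem_ofPred_eq, Set.mem_iUnion]
      constructor
      · intro h
        have h0 : π.type a ≠ 0 := h ▸ ht
        rw [Ne, π.type_eq_zero_iff] at h0
        push Not at h0
        obtain ⟨b, hb, hne⟩ := h0
        exact ⟨b, hne.symm, hb, h⟩
      · rintro ⟨b, _, _, h⟩
        exact h
    rw [this]
    exact MeasurableSet.iUnion fun b => MeasurableSet.iUnion fun hab => measurableSet_pair t hab
  by_cases ht : t = 0
  · have : {π : TypedPartition k ℕ | π.type a = t} =
        ⋂ s : Fin (k + 1), ⋂ (_ : s ≠ 0), {π | π.type a = s}ᶜ := by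
      ext π
      simp only [ht, Set.mem_ofPred_eq, Set.mem_iInter, Set.mem_compl_iff]
      constructor
      · rintro h s hs rfl
        exact hs h
      · intro h
        by_contra h0
        exact h _ h0 rfl
    rw [this]
    exact MeasurableSet.iInter fun s => MeasurableSet.iInter fun hs => (key s hs).compl
  · exact key t ht

theorem measurable_type (a : ℕ) : Measurable fun π : TypedPartition k ℕ => π.type a :=
  measurable_to_countable' fun t => measurableSet_type_eq a t

theorem measurable_of_pair {α : Type*} [MeasurableSpace α] {f : α → TypedPartition k ℕ}
    (h : ∀ a b t, a ≠ b → MeasurableSet {x | (f x).rel a b ∧ (f x).type a = t}) :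
    Measurable f := by
  rw [borel_eq_generateFrom_patternEvents k]
  refine measurable_generateFrom ?_
  rintro _ ⟨s, τ, -, rfl⟩
  have : f ⁻¹' pattern s τ = ⋂ a, ⋂ b, ⋂ (_ : a ≠ b), ⋂ (_ : s a b),
      {x | (f x).rel a b ∧ (f x).type a = τ a} := by
    ext x
    simp [pattern]
  rw [this]
  exact MeasurableSet.iInter fun a => MeasurableSet.iInter fun b => MeasurableSet.iInter fun hab =>
    MeasurableSet.iInter fun _ => h a b _ hab

theorem measurable_permute (σ : Equiv.Perm ℕ) :
    Measurable (permute σ : TypedPartition k ℕ → TypedPartition k ℕ) :=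
  measurable_of_pair fun _ _ t hab => measurableSet_pair t (σ.injective.ne hab)

theorem ofColours_rel_type {ω : ℕ → ℕ × Fin (k + 1)} {a b : ℕ} {t : Fin (k + 1)} (hab : a ≠ b) :
    ((ofColours ω).rel a b ∧ (ofColours ω).type a = t) ↔
      ω a = ω b ∧ 1 ≤ (ω b).1 ∧ (ω b).2 ≠ 0 ∧ (ω b).2 = t := by
  have hr : (ofColours ω).rel a b ↔ a = b ∨ (ω a = ω b ∧ 1 ≤ (ω b).1 ∧ (ω b).2 ≠ 0) := Iff.rfl
  rw [hr]
  simp only [hab, false_or]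
  constructor
  · rintro ⟨⟨h, h1, h2⟩, ht⟩
    simp only [ofColours] at ht
    rw [if_pos ⟨b, hab.symm, h, h1, h2⟩, h] at ht
    exact ⟨h, h1, h2, ht⟩
  · rintro ⟨h, h1, h2, ht⟩
    refine ⟨⟨h, h1, h2⟩, ?_⟩
    simp only [ofColours]
    rw [if_pos ⟨b, hab.symm, h, h1, h2⟩, h, ht]

theorem measurable_ofColours :
    Measurable (ofColours : (ℕ → ℕ × Fin (k + 1)) → TypedPartition k ℕ) := by
  refine measurable_of_pair fun a b t hab => ?_
  simp only [ofColours_rel_type hab]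
  have ha : Measurable fun ω : ℕ → ℕ × Fin (k + 1) => (ω a, ω b) :=
    (measurable_pi_apply a).prodMk (measurable_pi_apply b)
  exact ha (MeasurableSet.of_discrete (s := {p : (ℕ × Fin (k + 1)) × (ℕ × Fin (k + 1)) |
    p.1 = p.2 ∧ 1 ≤ p.2.1 ∧ p.2.2 ≠ 0 ∧ p.2.2 = t}))

open Classical in
theorem permute_ofColours (σ : Equiv.Perm ℕ) (ω : ℕ → ℕ × Fin (k + 1)) :
    permute σ (ofColours ω) = ofColours (fun n => ω (σ n)) := by
  refine TypedPartition.ext ?_ ?_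
  · ext a b
    change (σ a = σ b ∨ _) ↔ (a = b ∨ _)
    rw [σ.injective.eq_iff]
  · funext a
    simp only [permute, ofColours]
    have : (∃ m, m ≠ σ a ∧ ω (σ a) = ω m ∧ 1 ≤ (ω m).1 ∧ (ω m).2 ≠ 0) ↔
        ∃ m, m ≠ a ∧ ω (σ a) = ω (σ m) ∧ 1 ≤ (ω (σ m)).1 ∧ (ω (σ m)).2 ≠ 0 := by
      rw [← σ.exists_congr_right]
      simp
    exact if_congr this rfl rfl

/-! ### Prescribed events as disjoint sets inside blocks -/

/-- The event that the points of `A` lie in one block, of type `t`. -/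
def sameBlock (A : Finset ℕ) (t : Fin (k + 1)) : Set (TypedPartition k ℕ) :=
  {π | ∀ a ∈ A, π.type a = t ∧ ∀ b ∈ A, π.rel a b}

theorem measurableSet_sameBlock (A : Finset ℕ) (t : Fin (k + 1)) :
    MeasurableSet (sameBlock A t) := by
  have : sameBlock A t = ⋂ a ∈ A, ({π : TypedPartition k ℕ | π.type a = t} ∩
      ⋂ b ∈ A, {π | π.rel a b}) := by
    ext π
    simp [sameBlock]
  rw [this]
  exact A.measurableSet_biInter fun a _ => (measurableSet_type_eq a t).inter
    (A.measurableSet_biInter fun b _ => measurableSet_rel a b)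

open Classical in
/-- A non-empty pattern amounts to a finite family of disjoint sets, with at least two points each,
contained in blocks of prescribed types. -/
theorem exists_pattern_eq_iInter_sameBlock {s : Setoid ℕ} {τ : ℕ → Fin (k + 1)}
    (hs : (nontrivialPoints s).Finite) (hne : (pattern s τ).Nonempty) :
    ∃ (J : Finset (Finset ℕ)) (θ : Finset ℕ → Fin (k + 1)),
      (J : Set (Finset ℕ)).PairwiseDisjoint id ∧ (∀ A ∈ J, 2 ≤ A.card) ∧ (∀ A ∈ J, θ A ≠ 0) ∧
      pattern s τ = ⋂ A ∈ J, sameBlock A (θ A) := by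
  obtain ⟨π₀, h₀⟩ := hne
  have hle := le_rel_of_mem_pattern h₀
  let cl : ℕ → Finset ℕ := fun a => hs.toFinset.filter fun b => s a b
  let J := hs.toFinset.image cl
  -- The type of `π₀` at any point of `A` would do, since `A` lies in one of its blocks; the least
  -- point is a canonical choice, and the value at the empty set plays no role.
  let θ : Finset ℕ → Fin (k + 1) := fun A => if h : A.Nonempty then π₀.type (A.min' h) else 0
  have hcl : ∀ a b, a ∈ hs.toFinset → (b ∈ cl a ↔ s a b) := by
    intro a b ha
    simp only [cl, Finset.mem_filter, Set.Finite.mem_toFinset, and_iff_right_iff_imp]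
    intro hab
    rw [Set.Finite.mem_toFinset] at ha
    by_cases h : b = a
    · rwa [h]
    · exact ⟨a, fun h' => h h'.symm, s.symm' hab⟩
  have hself : ∀ a, a ∈ hs.toFinset → a ∈ cl a := fun a ha => (hcl a a ha).2 (s.refl' a)
  have hθ : ∀ a ∈ hs.toFinset, θ (cl a) = π₀.type a := by
    intro a ha
    have hn : (cl a).Nonempty := ⟨a, hself a ha⟩
    simp only [θ, dif_pos hn]
    exact (π₀.type_congr _ _ (hle ((hcl a _ ha).1 ((cl a).min'_mem hn)))).symm
  have hmemJ : ∀ A ∈ J, ∃ a ∈ hs.toFinset, cl a = A := fun A hA => Finset.mem_image.1 hA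
  refine ⟨J, θ, ?_, ?_, ?_, ?_⟩
  · intro A hA B hB hAB
    obtain ⟨a, ha, rfl⟩ := hmemJ A hA
    obtain ⟨b, hb, rfl⟩ := hmemJ B hB
    refine Finset.disjoint_left.2 fun c hca hcb => hAB ?_
    have h1 := (hcl a c ha).1 hca
    have h2 := (hcl b c hb).1 hcb
    have h3 : s a b := s.trans' h1 (s.symm' h2)
    ext d
    rw [hcl a d ha, hcl b d hb]
    exact ⟨fun h => s.trans' (s.symm' h3) h, fun h => s.trans' h3 h⟩
  · intro A hA
    obtain ⟨a, ha, rfl⟩ := hmemJ A hA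
    obtain ⟨b, hne, hab⟩ := hs.mem_toFinset.1 ha
    exact Finset.one_lt_card.2 ⟨a, hself a ha, b, (hcl a b ha).2 hab, hne.symm⟩
  · intro A hA
    obtain ⟨a, ha, rfl⟩ := hmemJ A hA
    obtain ⟨b, hne, hab⟩ := hs.mem_toFinset.1 ha
    rw [hθ a ha, Ne, π₀.type_eq_zero_iff]
    exact fun h => hne (h b (hle hab))
  · ext π
    simp only [Set.mem_iInter]
    constructor
    · intro h A hA a haA
      obtain ⟨c, hc, rfl⟩ := hmemJ A hA
      have hca := (hcl c a hc).1 haA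
      have hle' := le_rel_of_mem_pattern h
      refine ⟨?_, fun b hb => π.rel.trans' (π.rel.symm' (hle' hca)) (hle' ((hcl c b hc).1 hb))⟩
      obtain ⟨d, hne, hcd⟩ := hs.mem_toFinset.1 hc
      rw [hθ c hc, ← π.type_congr _ _ (hle' hca), (h c d hne.symm hcd).2, (h₀ c d hne.symm hcd).2]
    · intro h a b hne hab
      have ha : a ∈ hs.toFinset := hs.mem_toFinset.2 ⟨b, hne.symm, hab⟩
      have := h (cl a) (Finset.mem_image_of_mem _ ha) a (hself a ha)
      exact ⟨this.2 b ((hcl a b ha).2 hab),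
        by rw [this.1, hθ a ha, (h₀ a b hne hab).2]⟩

end TypedPartition

/-! ### Paintbox probabilities of prescribed events -/

namespace MassPartition

variable {k : ℕ}

/-- The sum of the `m`-th powers of the masses of type `t`. -/
def powerSum (x : MassPartition k) (m : ℕ) (t : Fin (k + 1)) : ℝ :=
  ∑' n, if x.type n = t then x.mass n ^ m else 0

theorem mass_le_one (x : MassPartition k) (n : ℕ) : x.mass n ≤ 1 :=
  (x.summable.le_tsum n fun j _ => x.nonneg j).trans x.tsum_le_one

theorem colourLaw_singleton (x : MassPartition k) (n : ℕ) (t : Fin (k + 1)) :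
    x.colourLaw {(n + 1, t)} = if x.type n = t then ENNReal.ofReal (x.mass n) else 0 := by
  have hm : MeasurableSet ({(n + 1, t)} : Set (ℕ × Fin (k + 1))) := MeasurableSet.of_discrete
  rw [colourLaw, Measure.add_apply, Measure.smul_apply, Measure.dirac_apply' _ hm,
    Measure.sum_apply _ hm, tsum_eq_single n]
  · by_cases h : x.type n = t <;> simp [h]
  · intro j hj
    simp [hj]

theorem summable_powerSum (x : MassPartition k) {m : ℕ} (hm : m ≠ 0) (t : Fin (k + 1)) :
    Summable fun n => if x.type n = t then x.mass n ^ m else 0 := by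
  refine Summable.of_nonneg_of_le (fun n => ?_) (fun n => ?_) x.summable
  · split_ifs
    · exact pow_nonneg (x.nonneg n) m
    · exact le_rfl
  · split_ifs
    · exact pow_le_of_le_one (x.nonneg n) (x.mass_le_one n) hm
    · exact x.nonneg n

theorem powerSum_nonneg (x : MassPartition k) (m : ℕ) (t : Fin (k + 1)) : 0 ≤ x.powerSum m t := by
  refine tsum_nonneg fun n => ?_
  split_ifs
  · exact pow_nonneg (x.nonneg n) m
  · exact le_rfl

theorem tsum_colourLaw_singleton_pow (x : MassPartition k) {m : ℕ} (hm : m ≠ 0)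
    (t : Fin (k + 1)) :
    ∑' n, x.colourLaw {(n + 1, t)} ^ m = ENNReal.ofReal (x.powerSum m t) := by
  rw [powerSum, ENNReal.ofReal_tsum_of_nonneg _ (x.summable_powerSum hm t)]
  · refine tsum_congr fun n => ?_
    rw [colourLaw_singleton]
    split_ifs
    · rw [ENNReal.ofReal_pow (x.nonneg n)]
    · simp [hm]
  · intro n
    split_ifs
    · exact pow_nonneg (x.nonneg n) m
    · exact le_rfl

end MassPartition

open Classical in
/-- For i.i.d. variables of law `ν`, the probability that disjoint finite sets `A` of coordinates
are monochromatic, of a colour `c n A`, given the values of finitely many other coordinates. -/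
theorem infinitePi_monochromatic {X : Type*} [MeasurableSpace X] [MeasurableSingletonClass X]
    (ν : Measure X) [IsProbabilityMeasure ν] (c : ℕ → Finset ℕ → X)
    (hc : ∀ A, Function.Injective fun n => c n A) (J : Finset (Finset ℕ))
    (hJ : (J : Set (Finset ℕ)).PairwiseDisjoint id) (hne : ∀ A ∈ J, A.Nonempty)
    (V : Finset ℕ) (v : ℕ → X) (hV : ∀ A ∈ J, Disjoint V A) :
    MeasurableSet {ω : ℕ → X | (∀ a ∈ V, ω a = v a) ∧ ∀ A ∈ J, ∃ n, ∀ a ∈ A, ω a = c n A} ∧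
    Measure.infinitePi (fun _ : ℕ => ν)
      {ω | (∀ a ∈ V, ω a = v a) ∧ ∀ A ∈ J, ∃ n, ∀ a ∈ A, ω a = c n A} =
        (∏ a ∈ V, ν {v a}) * ∏ A ∈ J, ∑' n, ν {c n A} ^ A.card := by
  induction J using Finset.induction_on generalizing V v with
  | empty =>
    have : {ω : ℕ → X | (∀ a ∈ V, ω a = v a) ∧ ∀ A ∈ (∅ : Finset (Finset ℕ)),
        ∃ n, ∀ a ∈ A, ω a = c n A} = Set.pi V fun a => {v a} := by
      ext ω
      simp [Set.mem_pi]
    rw [this]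
    refine ⟨MeasurableSet.pi V.countable_toSet fun a _ => measurableSet_singleton _, ?_⟩
    rw [Measure.infinitePi_pi _ fun a _ => measurableSet_singleton _]
    simp
  | insert A J hA ih =>
    have hJ' : (J : Set (Finset ℕ)).PairwiseDisjoint id :=
      hJ.subset (by simp)
    have hVA : Disjoint V A := hV A (Finset.mem_insert_self _ _)
    -- Once the colour `c n A` is chosen, the coordinates in `A` join the prescribed ones. The event
    -- is the disjoint union of these cases over `n`.
    have ih' := fun n : ℕ => ih hJ' (fun B hB => hne B (Finset.mem_insert_of_mem hB)) (V ∪ A)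
      (fun a => if a ∈ A then c n A else v a) (fun B hB => by
        rw [Finset.disjoint_union_left]
        refine ⟨hV B (Finset.mem_insert_of_mem hB), ?_⟩
        exact hJ (by simp) (by simp [hB]) (by rintro rfl; exact hA hB))
    have hset : {ω : ℕ → X | (∀ a ∈ V, ω a = v a) ∧ ∀ B ∈ insert A J,
        ∃ n, ∀ a ∈ B, ω a = c n B} = ⋃ n, {ω | (∀ a ∈ V ∪ A, ω a = if a ∈ A then c n A else v a) ∧
          ∀ B ∈ J, ∃ n, ∀ a ∈ B, ω a = c n B} := by
      ext ω
      simp only [Set.mem_ofPred_eq, Finset.forall_mem_insert, Set.mem_iUnion]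
      constructor
      · rintro ⟨h1, ⟨n, h2⟩, h3⟩
        refine ⟨n, fun a ha => ?_, h3⟩
        split_ifs with haA
        · exact h2 a haA
        · exact h1 a ((Finset.mem_union.1 ha).resolve_right haA)
      · rintro ⟨n, h1, h3⟩
        refine ⟨fun a ha => ?_, ⟨n, fun a ha => ?_⟩, h3⟩
        · rw [h1 a (Finset.mem_union_left _ ha), if_neg (Finset.disjoint_left.1 hVA ha)]
        · rw [h1 a (Finset.mem_union_right _ ha), if_pos ha]
    rw [hset]
    refine ⟨MeasurableSet.iUnion fun n => (ih' n).1, ?_⟩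
    rw [measure_iUnion _ fun n => (ih' n).1]
    · simp_rw [fun n => (ih' n).2]
      have hprod : ∀ n, ∏ a ∈ V ∪ A, ν {if a ∈ A then c n A else v a} =
          (∏ a ∈ V, ν {v a}) * ν {c n A} ^ A.card := by
        intro n
        rw [Finset.prod_union hVA]
        congr 1
        · exact Finset.prod_congr rfl fun a ha => by rw [if_neg (Finset.disjoint_left.1 hVA ha)]
        · rw [Finset.prod_congr rfl fun a ha => by rw [if_pos ha]]
          simp
      simp_rw [hprod]
      rw [ENNReal.tsum_mul_right, ENNReal.tsum_mul_left, Finset.prod_insert hA, mul_assoc]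
    · intro n n' hnn'
      refine Set.disjoint_left.2 fun ω h h' => hnn' (hc A ?_)
      obtain ⟨a, ha⟩ := hne A (Finset.mem_insert_self _ _)
      have h1 := h.1 a (Finset.mem_union_right _ ha)
      have h2 := h'.1 a (Finset.mem_union_right _ ha)
      rw [if_pos ha] at h1 h2
      exact h1.symm.trans h2

namespace TypedPartition

variable {k : ℕ}

/-- Coalescence requires a positive first coordinate, written `n + 1` here. Two points are needed,
since a singleton gets type `0` whatever its colour. -/
theorem ofColours_mem_sameBlock {ω : ℕ → ℕ × Fin (k + 1)} {A : Finset ℕ} {t : Fin (k + 1)}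
    (hA : 2 ≤ A.card) (ht : t ≠ 0) :
    ofColours ω ∈ sameBlock A t ↔ ∃ n, ∀ a ∈ A, ω a = (n + 1, t) := by
  constructor
  · intro h
    obtain ⟨a, ha, b, hb, hab⟩ := Finset.one_lt_card.1 hA
    have key : ∀ c ∈ A, c ≠ b → _ := fun c hc hcb =>
      (ofColours_rel_type hcb).1 ⟨(h c hc).2 b hb, (h c hc).1⟩
    obtain ⟨-, h1, -, h3⟩ := key a ha hab
    have hb' : ω b = ((ω b).1 - 1 + 1, t) := Prod.ext (by simp; omega) h3
    refine ⟨(ω b).1 - 1, fun c hc => ?_⟩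
    rw [← hb']
    by_cases hcb : c = b
    · rw [hcb]
    · exact (key c hc hcb).1
  · rintro ⟨n, hn⟩ a ha
    have key : ∀ b ∈ A, a ≠ b → (ofColours ω).rel a b ∧ (ofColours ω).type a = t := by
      intro b hb hab
      rw [ofColours_rel_type hab, hn a ha, hn b hb]
      exact ⟨rfl, by simp, ht, rfl⟩
    refine ⟨?_, fun b hb => ?_⟩
    · obtain ⟨b, hb, hne⟩ := Finset.exists_mem_ne hA a
      exact (key b hb hne.symm).2
    · by_cases hab : a = b
      · rw [hab]
      · exact (key b hb hab).1

end TypedPartition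

open TypedPartition

/-- All points of `A` have colour `n + 1` with probability `xₙ ^ |A|`. The sum runs over the colours
of type `θ A`, and disjoint sets are independent. -/
theorem paintbox_iInter_sameBlock {k : ℕ} (x : MassPartition k) {J : Finset (Finset ℕ)}
    {θ : Finset ℕ → Fin (k + 1)} (hJ : (J : Set (Finset ℕ)).PairwiseDisjoint id)
    (hcard : ∀ A ∈ J, 2 ≤ A.card) (hθ : ∀ A ∈ J, θ A ≠ 0) :
    paintbox x (⋂ A ∈ J, sameBlock A (θ A)) =
      ENNReal.ofReal (∏ A ∈ J, x.powerSum A.card (θ A)) := by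
  rw [paintbox, Measure.map_apply measurable_ofColours
    (J.measurableSet_biInter fun A _ => measurableSet_sameBlock A _)]
  have key := (infinitePi_monochromatic x.colourLaw (fun n A => (n + 1, θ A))
    (fun A n n' h => by simpa using h) J hJ
    (fun A hA => Finset.card_pos.1 (by have := hcard A hA; omega)) ∅ (fun _ => (0, 0))
    (fun A _ => Finset.disjoint_empty_left _)).2
  convert key using 1
  · congr 1
    ext ω
    simp only [Set.mem_preimage, Set.mem_iInter, Finset.notMem_empty, false_imp_iff,
      imp_true_iff, true_and, Set.mem_ofPred_eq]
    exact forall₂_congr fun A hA => ofColours_mem_sameBlock (hcard A hA) (hθ A hA)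
  · rw [Finset.prod_empty, one_mul, ENNReal.ofReal_prod_of_nonneg
      fun A _ => x.powerSum_nonneg _ _]
    refine Finset.prod_congr rfl fun A hA => ?_
    rw [x.tsum_colourLaw_singleton_pow (by have := hcard A hA; omega)]

instance {k : ℕ} (x : MassPartition k) : IsProbabilityMeasure (paintbox x) :=
  Measure.isProbabilityMeasure_map measurable_ofColours.aemeasurable

theorem exchangeable_paintbox {k : ℕ} (x : MassPartition k) : Exchangeable (paintbox x) := by
  intro σ _
  rw [paintbox, Measure.map_map (measurable_permute σ) measurable_ofColours]
  have h : permute σ ∘ ofColours = ofColours ∘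
      fun (ω : ℕ → ℕ × Fin (k + 1)) (n : ℕ) => ω (σ n) :=
    funext fun ω => permute_ofColours σ ω
  have hσ : Measurable fun (ω : ℕ → ℕ × Fin (k + 1)) (n : ℕ) => ω (σ n) :=
    measurable_pi_lambda _ fun n => measurable_pi_apply (σ n)
  rw [h, ← Measure.map_map measurable_ofColours hσ]
  congr 1
  have := Measure.infinitePi_map_piCongrLeft (fun _ : ℕ => x.colourLaw) σ.symm
  convert this using 2
  funext ω n
  obtain ⟨m, rfl⟩ := σ.symm.surjective n
  rw [MeasurableEquiv.coe_piCongrLeft, Equiv.piCongrLeft_apply_apply, σ.apply_symm_apply]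

/-! ### Weak topology of mass-partitions and continuity of power sums -/

namespace MassPartition

variable {k : ℕ}

open scoped BoundedContinuousFunction in
theorem summable_mass_mul (x : MassPartition k) (f : EuclideanSpace ℝ (Fin k) →ᵇ ℝ) :
    Summable fun n => x.mass n * f (x.mass n • axis (x.type n)) := by
  refine Summable.of_norm_bounded (x.summable.mul_right ‖f‖) fun n => ?_
  rw [norm_mul, Real.norm_of_nonneg (x.nonneg n)]
  exact mul_le_mul_of_nonneg_left (f.norm_coe_le_norm _) (x.nonneg n)

open scoped BoundedContinuousFunction in
-- Substituting `x₀ = 1 - ∑ xₙ` eliminates the dust. The remaining series has summands that vanish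
-- with the mass, so it does not see the order or the padding by zeros.
theorem integral_phi (x : MassPartition k) (f : EuclideanSpace ℝ (Fin k) →ᵇ ℝ) :
    ∫ y, f y ∂x.phi = f 0 + ∑' n, x.mass n * (f (x.mass n • axis (x.type n)) - f 0) := by
  have hint : Integrable f x.phi := f.integrable _
  have hd : 0 ≤ x.dust := sub_nonneg.2 x.tsum_le_one
  have h2 := hint
  rw [phi, integrable_add_measure] at h2
  rw [phi, integral_add_measure h2.1 h2.2, integral_smul_measure, integral_dirac,
    integral_sum_measure h2.2]
  simp_rw [integral_smul_measure, integral_dirac, mul_sub, smul_eq_mul,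
    ENNReal.toReal_ofReal (x.nonneg _), ENNReal.toReal_ofReal hd]
  rw [(x.summable_mass_mul f).tsum_sub (x.summable.mul_right _), tsum_mul_right, dust]
  ring

/-- The Prohorov distance metrizes weak convergence on a Euclidean space, so convergence can be
tested on bounded continuous functions. -/
theorem isInducing_phiProb : IsInducing (phiProb : MassPartition k → _) := by
  have h : IsInducing (fun x : MassPartition k => LevyProkhorov.ofMeasure x.phiProb) := ⟨rfl⟩
  exact (LevyProkhorov.probabilityMeasureHomeomorph
    (Ω := EuclideanSpace ℝ (Fin k))).symm.isInducing.comp h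

open scoped BoundedContinuousFunction in
theorem tendsto_iff_integral_phi {α : Type*} {l : Filter α} {u : α → MassPartition k}
    {x : MassPartition k} : Tendsto u l (𝓝 x) ↔ ∀ f : EuclideanSpace ℝ (Fin k) →ᵇ ℝ,
      Tendsto (fun i => ∫ y, f y ∂(u i).phi) l (𝓝 (∫ y, f y ∂x.phi)) := by
  rw [isInducing_phiProb.tendsto_nhds_iff, ProbabilityMeasure.tendsto_iff_forall_integral_tendsto]
  rfl

open scoped BoundedContinuousFunction in
theorem continuous_integral_phi (f : EuclideanSpace ℝ (Fin k) →ᵇ ℝ) :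
    Continuous fun x : MassPartition k => ∫ y, f y ∂x.phi :=
  continuous_iff_continuousAt.2 fun _ => tendsto_iff_integral_phi.1 tendsto_id f

/-- One factor `xₙ` is the weight of the atom under `φ_x`; the other `m - 1` are read off from its
position on the axis of type `t`. Since `m ≥ 2`, the test function vanishes at `0`, where the dust
and the other axes project. Truncation to `[0, 1]` makes it bounded without changing it at the
atoms. -/
theorem continuous_powerSum {m : ℕ} (hm : 2 ≤ m) {t : Fin (k + 1)} (ht : t ≠ 0) :
    Continuous fun x : MassPartition k => x.powerSum m t := by
  obtain ⟨j, rfl⟩ := Fin.exists_succ_eq.2 ht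
  let f : BoundedContinuousFunction (EuclideanSpace ℝ (Fin k)) ℝ :=
    BoundedContinuousFunction.ofNormedAddCommGroup (fun y => max 0 (min 1 (y j)) ^ (m - 1))
      (by fun_prop) 1 (fun y => by
        have h0 : 0 ≤ max 0 (min 1 (y j)) := le_max_left _ _
        rw [Real.norm_of_nonneg (pow_nonneg h0 _)]
        exact pow_le_one₀ h0 (max_le zero_le_one (min_le_left _ _)))
  have hf : ∀ y, f y = max 0 (min 1 (y j)) ^ (m - 1) := fun y => rfl
  convert continuous_integral_phi f using 2 with x
  have hm1 : m - 1 ≠ 0 := by omega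
  have h0 : f 0 = 0 := by simp [hf, hm1]
  rw [integral_phi, h0, zero_add, powerSum]
  refine tsum_congr fun n => ?_
  rw [hf, sub_zero]
  rcases Fin.eq_zero_or_eq_succ (x.type n) with h | ⟨i, h⟩
  · have : x.mass n = 0 := (x.mass_eq_zero_iff n).2 h
    simp [this, h, (Fin.succ_ne_zero j).symm]
  · rw [h]
    by_cases hij : i = j
    · subst hij
      have : max 0 (min 1 ((x.mass n • axis i.succ : EuclideanSpace ℝ (Fin k)) i)) = x.mass n := by
        simp [axis, x.nonneg n, x.mass_le_one n]
      rw [this, if_pos rfl, ← pow_succ', Nat.sub_add_cancel (by omega)]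
    · have : (x.mass n • axis i.succ : EuclideanSpace ℝ (Fin k)) j = 0 := by
        simp [axis, Ne.symm hij]
      rw [this, if_neg (by simpa using hij)]
      simp [hm1]

end MassPartition

/-! ### Measurability of the paintbox and mixtures of paintboxes -/

theorem measurable_paintbox (k : ℕ) :
    Measurable (paintbox : MassPartition k → Measure (TypedPartition k ℕ)) := by
  refine Measurable.measure_of_isPiSystem_of_isProbabilityMeasure
    (borel_eq_generateFrom_patternEvents k) (isPiSystem_patternEvents k) ?_
  rintro _ ⟨s, τ, hs, rfl⟩
  rcases (pattern s τ).eq_empty_or_nonempty with h | h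
  · simp [h]
  obtain ⟨J, θ, hJ, hcard, hθ, heq⟩ := exists_pattern_eq_iInter_sameBlock hs h
  rw [heq]
  simp_rw [paintbox_iInter_sameBlock _ hJ hcard hθ]
  refine ENNReal.measurable_ofReal.comp ?_
  exact (continuous_finsetProd J fun A hA =>
    MassPartition.continuous_powerSum (hcard A hA) (hθ A hA)).measurable

theorem isProbabilityMeasure_bind_paintbox {k : ℕ} (ϱ : Measure (MassPartition k))
    [IsProbabilityMeasure ϱ] : IsProbabilityMeasure (ϱ.bind paintbox) := by
  refine ⟨?_⟩
  rw [Measure.bind_apply MeasurableSet.univ (measurable_paintbox k).aemeasurable]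
  simp

theorem exchangeable_bind_paintbox {k : ℕ} (ϱ : Measure (MassPartition k)) :
    Exchangeable (ϱ.bind paintbox) := by
  intro σ hσ
  ext A hA
  rw [Measure.map_apply (measurable_permute σ) hA,
    Measure.bind_apply (measurable_permute σ hA) (measurable_paintbox k).aemeasurable,
    Measure.bind_apply hA (measurable_paintbox k).aemeasurable]
  refine lintegral_congr fun x => ?_
  rw [← Measure.map_apply (measurable_permute σ) hA, exchangeable_paintbox x σ hσ]

/-! ### Ranking a summable family of masses with types -/

variable {k : ℕ}

/-- The positive terms of `x` are the pairs `(m i, t i)` with `m i > 0`, ranked. -/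
def Ranks (m : ℕ → ℝ) (t : ℕ → Fin (k + 1)) (x : MassPartition k) : Prop :=
  ∃ e : {i // 0 < m i} ≃ {n // 0 < x.mass n},
    ∀ i, x.mass (e i) = m i ∧ x.type (e i) = t i

/-- Ranking only rearranges the positive terms. Functionals of the ranked sequence can thus be
computed on the unranked family. -/
theorem Ranks.tsum_eq {m : ℕ → ℝ} {t : ℕ → Fin (k + 1)} {x : MassPartition k} (h : Ranks m t x)
    (hm : ∀ i, 0 ≤ m i) {g : ℝ → Fin (k + 1) → ℝ} (hg : ∀ s, g 0 s = 0) :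
    ∑' n, g (x.mass n) (x.type n) = ∑' i, g (m i) (t i) := by
  obtain ⟨e, he⟩ := h
  have h1 : ∑' n : {n // 0 < x.mass n}, g (x.mass n) (x.type n) =
      ∑' n, g (x.mass n) (x.type n) := by
    refine tsum_subtype_eq_of_support_subset (s := {n | 0 < x.mass n})
      (f := fun n => g (x.mass n) (x.type n)) fun n hn => ?_
    refine lt_of_le_of_ne (x.nonneg n) fun h0 => hn ?_
    simp only
    rw [← h0, hg]
  have h2 : ∑' i : {i // 0 < m i}, g (m i) (t i) = ∑' i, g (m i) (t i) := by
    refine tsum_subtype_eq_of_support_subset (s := {i | 0 < m i})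
      (f := fun i => g (m i) (t i)) fun i hi => ?_
    refine lt_of_le_of_ne (hm i) fun h0 => hi ?_
    simp only
    rw [← h0, hg]
  rw [← h1, ← h2, ← e.tsum_eq]
  exact tsum_congr fun i => by rw [(he i).1, (he i).2]

section Ranking

variable (m : ℕ → ℝ) (t : ℕ → Fin (k + 1))

/-- The key that sorts indices by mass, then type, then decreasing index. -/
def rankingKey (i : ℕ) : ℝ ×ₗ (Fin (k + 1) ×ₗ ℕᵒᵈ) :=
  toLex (m i, toLex (t i, OrderDual.toDual i))

/-- The indices of positive mass that precede `i` in the ranking. -/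
def precedingIndices (i : ℕ) : Set ℕ := {j | 0 < m j ∧ rankingKey m t i < rankingKey m t j}

variable {m t}

theorem rankingKey_injective : Function.Injective (rankingKey m t) := by
  intro i j h
  simp only [rankingKey, EmbeddingLike.apply_eq_iff_eq, Prod.mk.injEq] at h
  exact h.2.2

theorem mass_le_of_rankingKey_lt {i j : ℕ} (h : rankingKey m t i < rankingKey m t j) :
    m i < m j ∨ (m i = m j ∧ t i ≤ t j) := by
  rcases Prod.Lex.toLex_lt_toLex.1 h with h | ⟨h, h'⟩
  · exact Or.inl h
  · refine Or.inr ⟨h, ?_⟩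
    rcases Prod.Lex.toLex_lt_toLex.1 h' with h | ⟨h, -⟩
    · exact h.le
    · exact h.le

theorem finite_precedingIndices (hs : Summable m) {i : ℕ} (hi : 0 < m i) :
    (precedingIndices m t i).Finite := by
  have h := hs.tendsto_cofinite_zero.eventually (gt_mem_nhds hi)
  refine Set.Finite.subset h fun j hj => ?_
  have : m i ≤ m j := (mass_le_of_rankingKey_lt hj.2).elim le_of_lt fun h => h.1.le
  simpa using this

theorem ncard_precedingIndices_lt (hs : Summable m) {i j : ℕ} (hi : 0 < m i) (hj : 0 < m j)
    (h : rankingKey m t i < rankingKey m t j) :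
    (precedingIndices m t j).ncard < (precedingIndices m t i).ncard := by
  refine Set.ncard_lt_ncard ⟨fun l hl => ⟨hl.1, h.trans hl.2⟩, fun hsub => ?_⟩
    (finite_precedingIndices hs hi)
  exact lt_irrefl _ (hsub (⟨hj, h⟩ : j ∈ precedingIndices m t i)).2

theorem eq_of_ncard_precedingIndices_eq (hs : Summable m) {i j : ℕ} (hi : 0 < m i) (hj : 0 < m j)
    (h : (precedingIndices m t i).ncard = (precedingIndices m t j).ncard) : i = j := by
  rcases lt_trichotomy (rankingKey m t i) (rankingKey m t j) with h' | h' | h'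
  · exact absurd h (ncard_precedingIndices_lt hs hi hj h').ne'
  · exact rankingKey_injective h'
  · exact absurd h (ncard_precedingIndices_lt hs hj hi h').ne

/-- The index with the least key among those preceding `i` is preceded by all of these but itself.
Hence the ranks leave no gap. -/
theorem exists_ncard_precedingIndices_eq (hs : Summable m) {i n : ℕ} (hi : 0 < m i)
    (h : (precedingIndices m t i).ncard = n + 1) :
    ∃ j, 0 < m j ∧ (precedingIndices m t j).ncard = n ∧ rankingKey m t i < rankingKey m t j := by
  have hfin := finite_precedingIndices (t := t) hs hi
  have hne : (precedingIndices m t i).Nonempty := Set.nonempty_of_ncard_ne_zero (by omega)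
  obtain ⟨j, hj, hmin⟩ := Set.exists_min_image _ (rankingKey m t) hfin hne
  refine ⟨j, hj.1, ?_, hj.2⟩
  have : precedingIndices m t j = precedingIndices m t i \ {j} := by
    ext l
    constructor
    · intro hl
      refine ⟨⟨hl.1, hj.2.trans hl.2⟩, ?_⟩
      rintro rfl
      exact lt_irrefl _ hl.2
    · rintro ⟨hl, hlj⟩
      exact ⟨hl.1, lt_of_le_of_ne (hmin l hl) fun h => hlj (rankingKey_injective h).symm⟩
  rw [this, Set.ncard_sdiff_singleton_of_mem hj, h]
  omega

open Classical in
-- The index `i` goes to the position given by the number of indices that precede it, which is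
-- finite by summability. Positions that are not reached receive `(0, 0)`.
theorem exists_ranks (hm : ∀ i, 0 ≤ m i) (hs : Summable m) (h1 : ∑' i, m i ≤ 1)
    (ht : ∀ i, 0 < m i → t i ≠ 0) : ∃ x : MassPartition k, Ranks m t x := by
  let r : ℕ → ℕ := fun i => (precedingIndices m t i).ncard
  let M : ℕ → ℝ := fun n => if h : ∃ i, 0 < m i ∧ r i = n then m h.choose else 0
  let T : ℕ → Fin (k + 1) := fun n => if h : ∃ i, 0 < m i ∧ r i = n then t h.choose else 0
  have hchoose : ∀ i, 0 < m i → ∀ h : ∃ j, 0 < m j ∧ r j = r i, h.choose = i := fun i hi h =>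
    eq_of_ncard_precedingIndices_eq hs h.choose_spec.1 hi h.choose_spec.2
  have hMr : ∀ i, 0 < m i → M (r i) = m i := by
    intro i hi
    have h : ∃ j, 0 < m j ∧ r j = r i := ⟨i, hi, rfl⟩
    simp only [M, dif_pos h, hchoose i hi h]
  have hTr : ∀ i, 0 < m i → T (r i) = t i := by
    intro i hi
    have h : ∃ j, 0 < m j ∧ r j = r i := ⟨i, hi, rfl⟩
    simp only [T, dif_pos h, hchoose i hi h]
  have hout : ∀ n, (¬ ∃ i, 0 < m i ∧ r i = n) → M n = 0 ∧ T n = 0 := fun n h =>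
    ⟨dif_neg h, dif_neg h⟩
  have hinj : Function.Injective fun i : {i // 0 < m i} => r i := fun i j h =>
    Subtype.ext (eq_of_ncard_precedingIndices_eq hs i.2 j.2 h)
  have hsupp : ∀ n ∉ Set.range (fun i : {i // 0 < m i} => r i), M n = 0 := fun n hn =>
    (hout n fun ⟨i, hi, h⟩ => hn ⟨⟨i, hi⟩, h⟩).1
  have hcomp : (M ∘ fun i : {i // 0 < m i} => r i) =
      fun i : {i // 0 < m i} => m i := funext fun i => hMr i i.2
  have hsum : Summable M := by
    rw [← hinj.summable_iff hsupp, hcomp]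
    exact hs.subtype _
  have htsum : ∑' n, M n = ∑' i, m i := by
    rw [← hinj.tsum_eq (fun n hn => by by_contra h; exact hn (hsupp n h))]
    refine (congrArg tsum hcomp).trans ?_
    exact tsum_subtype_eq_of_support_subset (s := {i | 0 < m i})
      fun i hi => lt_of_le_of_ne (hm i) fun h => hi h.symm
  have hstep : ∀ n, M (n + 1) < M n ∨ (M (n + 1) = M n ∧ T (n + 1) ≤ T n) ∨
      (M (n + 1) = 0 ∧ T (n + 1) = 0) := by
    intro n
    by_cases h : ∃ i, 0 < m i ∧ r i = n + 1
    · obtain ⟨i, hi, hr⟩ := h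
      obtain ⟨j, hj, hrj, hlt⟩ := exists_ncard_precedingIndices_eq hs hi hr
      have hrj' : r j = n := hrj
      rw [← hr, ← hrj', hMr i hi, hMr j hj, hTr i hi, hTr j hj]
      exact (mass_le_of_rankingKey_lt hlt).imp id Or.inl
    · exact Or.inr (Or.inr (hout _ h))
  have hM0 : ∀ n, 0 ≤ M n := by
    intro n
    simp only [M]
    split_ifs
    · exact hm _
    · exact le_rfl
  let x : MassPartition k :=
    { mass := M
      type := T
      nonneg := hM0
      mass_anti := fun n => by
        rcases hstep n with h | h | h
        · exact h.le
        · exact h.1.le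
        · rw [h.1]; exact hM0 n
      summable := hsum
      tsum_le_one := htsum.trans_le h1
      mass_eq_zero_iff := fun n => by
        by_cases h : ∃ i, 0 < m i ∧ r i = n
        · obtain ⟨i, hi, rfl⟩ := h
          rw [hMr i hi, hTr i hi]
          exact iff_of_false hi.ne' (ht i hi)
        · exact iff_of_true (hout n h).1 (hout n h).2
      type_anti := fun n h => by
        rcases hstep n with h' | h' | h'
        · exact absurd h h'.ne'
        · exact h'.2
        · rw [h'.2]; exact Fin.zero_le _ }
  refine ⟨x, Equiv.ofBijective
    (fun i => ⟨r i, show 0 < M (r i) by rw [hMr i i.2]; exact i.2⟩) ⟨?_, ?_⟩, ?_⟩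
  · exact fun i j h => hinj (congrArg Subtype.val h)
  · rintro ⟨n, hn⟩
    by_cases h : ∃ i, 0 < m i ∧ r i = n
    · obtain ⟨i, hi, rfl⟩ := h
      exact ⟨⟨i, hi⟩, rfl⟩
    · exact absurd (hout n h).1 (ne_of_gt hn)
  · exact fun i => ⟨hMr i i.2, hTr i i.2⟩

end Ranking

open Classical in
/-- A ranked version of the family of pairs `(m i, t i)`, if there is one. -/
def rankOf (m : ℕ → ℝ) (t : ℕ → Fin (k + 1)) : MassPartition k :=
  if h : ∃ x, Ranks m t x then h.choose else MassPartition.pureDust k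

theorem ranks_rankOf {m : ℕ → ℝ} {t : ℕ → Fin (k + 1)} (hm : ∀ i, 0 ≤ m i) (hs : Summable m)
    (h1 : ∑' i, m i ≤ 1) (ht : ∀ i, 0 < m i → t i ≠ 0) : Ranks m t (rankOf m t) := by
  have h : ∃ x : MassPartition k, Ranks m t x := exists_ranks hm hs h1 ht
  rw [rankOf, dif_pos h]
  exact h.choose_spec

open scoped BoundedContinuousFunction in
theorem Ranks.integral_phi {m : ℕ → ℝ} {t : ℕ → Fin (k + 1)} {x : MassPartition k}
    (h : Ranks m t x) (hm : ∀ i, 0 ≤ m i) (f : EuclideanSpace ℝ (Fin k) →ᵇ ℝ) :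
    ∫ y, f y ∂x.phi = f 0 + ∑' i, m i * (f (m i • MassPartition.axis (t i)) - f 0) := by
  rw [MassPartition.integral_phi, h.tsum_eq hm
    (g := fun a s => a * (f (a • MassPartition.axis s) - f 0)) fun s => by simp]

/-- Dominated convergence for ranked families. -/
theorem tendsto_of_ranks {M : ℕ → ℕ → ℝ} {m : ℕ → ℝ} {t : ℕ → Fin (k + 1)}
    {u : ℕ → MassPartition k} {x : MassPartition k} (hu : ∀ n, Ranks (M n) t (u n))
    (hx : Ranks m t x) (hM : ∀ n i, 0 ≤ M n i) (hle : ∀ n i, M n i ≤ m i) (hs : Summable m)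
    (hlim : ∀ i, Tendsto (fun n => M n i) atTop (𝓝 (m i))) : Tendsto u atTop (𝓝 x) := by
  rw [MassPartition.tendsto_iff_integral_phi]
  intro f
  have hm : ∀ i, 0 ≤ m i := fun i => (hM 0 i).trans (hle 0 i)
  rw [hx.integral_phi hm]
  -- All sums are now over the original indices, so it does not matter that the ranking changes with
  -- `n`.
  simp_rw [fun n => (hu n).integral_phi (hM n)]
  refine tendsto_const_nhds.add ?_
  refine tendsto_tsum_of_dominated_convergence (bound := fun i => m i * (‖f‖ + ‖f‖))
    (hs.mul_right _) (fun i => ?_) (Eventually.of_forall fun n i => ?_)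
  · exact (hlim i).mul (((f.continuous.tendsto _).comp ((hlim i).smul_const _)).sub_const _)
  · rw [norm_mul, Real.norm_of_nonneg (hM n i)]
    refine mul_le_mul (hle n i) ?_ (norm_nonneg _) (hm i)
    exact (norm_sub_le _ _).trans (add_le_add (f.norm_coe_le_norm _) (f.norm_coe_le_norm _))

/-! ### Existence of asymptotic frequencies -/

theorem ae_summable_of_summable_integral {Ω : Type*} [MeasurableSpace Ω] {μ : Measure Ω}
    {f : ℕ → Ω → ℝ} (h0 : ∀ n ω, 0 ≤ f n ω) (hf : ∀ n, Integrable (f n) μ)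
    (hs : Summable fun n => ∫ ω, f n ω ∂μ) : ∀ᵐ ω ∂μ, Summable fun n => f n ω := by
  -- By Tonelli, the sum has finite integral, so it is almost everywhere finite.
  have h : ∫⁻ ω, ∑' n, ENNReal.ofReal (f n ω) ∂μ ≠ ∞ := by
    rw [lintegral_tsum fun n => (hf n).aestronglyMeasurable.aemeasurable.ennreal_ofReal]
    simp_rw [← fun n => ofReal_integral_eq_lintegral_ofReal (hf n) (ae_of_all _ (h0 n))]
    exact hs.tsum_ofReal_ne_top
  have hm : AEMeasurable (fun ω => ∑' n, ENNReal.ofReal (f n ω)) μ :=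
    AEMeasurable.tsum fun n => (hf n).aestronglyMeasurable.aemeasurable.ennreal_ofReal
  filter_upwards [ae_lt_top' hm h] with ω hω
  have := ENNReal.summable_toReal hω.ne
  simpa only [ENNReal.toReal_ofReal (h0 _ ω)] using this

/-- Consecutive fourth powers have ratio tending to `1`, which allows the interpolation of monotone
sums between them. -/
theorem tendsto_succ_pow_four_ratio {a : ℝ} (ha : 1 < a) :
    ∀ᶠ n : ℕ in atTop, (((n + 1) ^ 4 : ℕ) : ℝ) ≤ a * ((n ^ 4 : ℕ) : ℝ) := by
  have h : Tendsto (fun n : ℕ => (1 + 1 / (n : ℝ)) ^ 4) atTop (𝓝 ((1 + 0) ^ 4)) :=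
    (tendsto_const_nhds.add tendsto_one_div_atTop_nhds_zero_nat).pow 4
  rw [add_zero, one_pow] at h
  filter_upwards [h.eventually (gt_mem_nhds ha), eventually_gt_atTop 0] with n hn hpos
  have hn0 : (0 : ℝ) < n := by exact_mod_cast hpos
  have : (((n + 1) ^ 4 : ℕ) : ℝ) = (1 + 1 / (n : ℝ)) ^ 4 * ((n ^ 4 : ℕ) : ℝ) := by
    push_cast
    field_simp
  rw [this]
  exact mul_le_mul_of_nonneg_right hn.le (by positivity)

theorem finite_swap_ne (a b : ℕ) : {n | Equiv.swap a b n ≠ n}.Finite := by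
  refine Set.Finite.subset (Set.toFinite {a, b}) fun n hn => ?_
  by_contra h
  simp only [Set.mem_insert_iff, Set.mem_singleton_iff, not_or] at h
  exact hn (Equiv.swap_apply_of_ne_of_ne h.1 h.2)

namespace TypedPartition

variable {k : ℕ}

open Classical in
/-- The indicator of the event that `a` and `b` are in the same block. -/
def link (a b : ℕ) (π : TypedPartition k ℕ) : ℝ := if π.rel a b then 1 else 0

theorem link_nonneg (a b : ℕ) (π : TypedPartition k ℕ) : 0 ≤ link a b π := by
  unfold link
  split_ifs <;> norm_num

theorem link_le_one (a b : ℕ) (π : TypedPartition k ℕ) : link a b π ≤ 1 := by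
  unfold link
  split_ifs <;> norm_num

theorem link_permute (σ : Equiv.Perm ℕ) (a b : ℕ) (π : TypedPartition k ℕ) :
    link a b (permute σ π) = link (σ a) (σ b) π := rfl

theorem measurable_link (a b : ℕ) : Measurable (link a b : TypedPartition k ℕ → ℝ) :=
  Measurable.ite (measurableSet_rel a b) measurable_const measurable_const

open Classical in
theorem proportion_eq_sum (B : Set ℕ) (n : ℕ) :
    proportion B n = (∑ i ∈ Finset.range n, if i ∈ B then (1 : ℝ) else 0) / n := by
  rw [proportion, Finset.sum_boole]
  congr 2
  rw [← Set.ncard_coe_finset]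
  congr 1
  ext i
  simp [and_comm]

theorem proportion_block (π : TypedPartition k ℕ) (a n : ℕ) :
    proportion (π.block a) n = (∑ i ∈ Finset.range n, link a i π) / n :=
  proportion_eq_sum _ _

theorem Exchangeable.integral_permute {ρ : Measure (TypedPartition k ℕ)} (h : Exchangeable ρ)
    {σ : Equiv.Perm ℕ} (hσ : {n | σ n ≠ n}.Finite) {f : TypedPartition k ℕ → ℝ}
    (hf : Measurable f) : ∫ π, f (permute σ π) ∂ρ = ∫ π, f π ∂ρ := by
  conv_rhs => rw [← h σ hσ]
  rw [integral_map (measurable_permute σ).aemeasurable hf.aestronglyMeasurable]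

theorem integrable_of_bounds {ρ : Measure (TypedPartition k ℕ)} [IsProbabilityMeasure ρ]
    {f : TypedPartition k ℕ → ℝ} (hf : Measurable f) (h0 : ∀ π, 0 ≤ f π) (h1 : ∀ π, f π ≤ 1) :
    Integrable f ρ :=
  Integrable.of_bound hf.aestronglyMeasurable 1
    (ae_of_all _ fun π => by rw [Real.norm_of_nonneg (h0 π)]; exact h1 π)

section Frequencies

variable {ρ : Measure (TypedPartition k ℕ)}

theorem integral_link_mul_link_eq (hρ : Exchangeable ρ) {a i j j' : ℕ} (hja : j ≠ a)
    (hja' : j' ≠ a) (hij : i ≠ j) (hij' : i ≠ j') :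
    ∫ π, link a i π * link a j π ∂ρ = ∫ π, link a i π * link a j' π ∂ρ := by
  rw [← hρ.integral_permute (finite_swap_ne j j')
    (f := fun π => link a i π * link a j π) ((measurable_link a i).mul (measurable_link a j))]
  simp only [link_permute, Equiv.swap_apply_left,
    Equiv.swap_apply_of_ne_of_ne hja.symm hja'.symm, Equiv.swap_apply_of_ne_of_ne hij hij']

theorem integral_link_mul_link_const (hρ : Exchangeable ρ) {a i j i' j' : ℕ} (hia : i ≠ a)
    (hja : j ≠ a) (hia' : i' ≠ a) (hja' : j' ≠ a) (hij : i ≠ j) (hij' : i' ≠ j') :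
    ∫ π, link a i π * link a j π ∂ρ = ∫ π, link a i' π * link a j' π ∂ρ := by
  -- A fresh index avoids collisions such as `i' = j`: the pair moves through `(i, l)` and `(i', l)`
  -- to `(i', j')`.
  obtain ⟨l, hl⟩ := Infinite.exists_notMem_finset ({a, i, j, i', j'} : Finset ℕ)
  simp only [Finset.mem_insert, Finset.mem_singleton, not_or] at hl
  obtain ⟨hla, hli, hlj, hli', hlj'⟩ := hl
  rw [integral_link_mul_link_eq hρ hja hla hij (Ne.symm hli)]
  simp_rw [mul_comm (link a i _)]
  rw [integral_link_mul_link_eq hρ hia hia' hli hli']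
  simp_rw [mul_comm (link a l _)]
  rw [integral_link_mul_link_eq hρ hla hja' (Ne.symm hli') hij']

theorem proportion_nonneg (B : Set ℕ) (n : ℕ) : 0 ≤ proportion B n := by
  unfold proportion
  positivity

theorem proportion_le_one (B : Set ℕ) (n : ℕ) : proportion B n ≤ 1 := by
  unfold proportion
  refine div_le_one_of_le₀ ?_ (Nat.cast_nonneg n)
  have h : (B ∩ Set.Iio n).ncard ≤ (Set.Iio n).ncard :=
    Set.ncard_le_ncard Set.inter_subset_right (Set.finite_Iio n)
  have h' : (Set.Iio n).ncard = n := by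
    rw [← Finset.coe_Iio, Set.ncard_coe_finset, Nat.card_Iio]
  exact_mod_cast h.trans h'.le

theorem measurable_proportion_block (a n : ℕ) :
    Measurable fun π : TypedPartition k ℕ => proportion (π.block a) n := by
  simp_rw [proportion_block]
  exact (Finset.measurable_fun_sum _ fun i _ => measurable_link a i).div_const _

/-- The proportions of a block in `[n]` and `[m]` are asymptotically perfectly correlated. -/
theorem abs_integral_proportion_mul_sub_le [IsProbabilityMeasure ρ] (hρ : Exchangeable ρ) (a : ℕ)
    {n m : ℕ} (hn : 0 < n) (hnm : n ≤ m) :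
    |∫ π, proportion (π.block a) n * proportion (π.block a) m ∂ρ -
      ∫ π, link a (a + 1) π * link a (a + 2) π ∂ρ| ≤ 3 / n := by
  set q := ∫ π, link a (a + 1) π * link a (a + 2) π ∂ρ with hq
  have hint : ∀ i j, Integrable (fun π => link a i π * link a j π) ρ := fun i j =>
    integrable_of_bounds ((measurable_link a i).mul (measurable_link a j))
      (fun π => mul_nonneg (link_nonneg _ _ _) (link_nonneg _ _ _))
      (fun π => mul_le_one₀ (link_le_one _ _ _) (link_nonneg _ _ _) (link_le_one _ _ _))
  have h01 : ∀ i j, 0 ≤ ∫ π, link a i π * link a j π ∂ρ ∧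
      ∫ π, link a i π * link a j π ∂ρ ≤ 1 := by
    intro i j
    refine ⟨integral_nonneg fun π => mul_nonneg (link_nonneg _ _ _) (link_nonneg _ _ _), ?_⟩
    calc _ ≤ ∫ _, (1 : ℝ) ∂ρ := integral_mono (hint i j) (integrable_const _)
          fun π => mul_le_one₀ (link_le_one _ _ _) (link_nonneg _ _ _) (link_le_one _ _ _)
      _ = 1 := by simp
  -- When `a`, `i`, `j` are distinct the moment is exactly `q`; the exceptional pairs cost at most
  -- `1` each.
  have hbound : ∀ i j, |∫ π, link a i π * link a j π ∂ρ - q| ≤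
      (if i = j then 1 else 0) + (if i = a then 1 else 0) + (if j = a then (1 : ℝ) else 0) := by
    intro i j
    by_cases h : i = j ∨ i = a ∨ j = a
    · have h1 : |∫ π, link a i π * link a j π ∂ρ - q| ≤ 1 :=
        abs_sub_le_of_nonneg_of_le (h01 i j).1 (h01 i j).2 (h01 _ _).1 (h01 _ _).2
      refine h1.trans ?_
      split_ifs <;> first | (exfalso; tauto) | norm_num
    · push Not at h
      rw [hq, integral_link_mul_link_const hρ h.2.1 h.2.2 (i' := a + 1) (j' := a + 2) (by omega)
        (by omega) h.1 (by omega)]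
      simp [h]
  have hm : 0 < m := hn.trans_le hnm
  have hnR : (0 : ℝ) < n := by exact_mod_cast hn
  have hmR : (0 : ℝ) < m := by exact_mod_cast hm
  have hexp : ∫ π, proportion (π.block a) n * proportion (π.block a) m ∂ρ =
      (∑ i ∈ Finset.range n, ∑ j ∈ Finset.range m, ∫ π, link a i π * link a j π ∂ρ) / (n * m) := by
    simp_rw [proportion_block, div_mul_div_comm, Finset.sum_mul_sum]
    rw [integral_div, integral_finsetSum _ fun i _ => integrable_finsetSum _ fun j _ => hint i j]
    simp_rw [integral_finsetSum _ fun j _ => hint _ j]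
  have hq' : q = (∑ i ∈ Finset.range n, ∑ j ∈ Finset.range m, q) / (n * m) := by
    simp
    field_simp
  rw [hexp]
  nth_rewrite 1 [hq']
  rw [← sub_div, abs_div, abs_of_pos (mul_pos hnR hmR), ← Finset.sum_sub_distrib]
  simp_rw [← Finset.sum_sub_distrib]
  rw [div_le_div_iff₀ (mul_pos hnR hmR) hnR]
  -- There are at most `n` pairs with `i = j`, `m` with `i = a` and `n` with `j = a`. As `n ≤ m`,
  -- the total is at most `3 * m`, and division by `n * m` leaves `3 / n`.
  have hsum : |∑ i ∈ Finset.range n, ∑ j ∈ Finset.range m,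
      (∫ π, link a i π * link a j π ∂ρ - q)| ≤ n + m + n := by
    calc _ ≤ ∑ i ∈ Finset.range n, ∑ j ∈ Finset.range m,
          ((if i = j then 1 else 0) + (if i = a then 1 else 0) + (if j = a then (1 : ℝ) else 0)) :=
        (Finset.abs_sum_le_sum_abs _ _).trans (Finset.sum_le_sum fun i _ =>
          (Finset.abs_sum_le_sum_abs _ _).trans (Finset.sum_le_sum fun j _ => hbound i j))
      _ ≤ n + m + n := by
        simp_rw [Finset.sum_add_distrib]
        refine add_le_add (add_le_add ?_ ?_) ?_
        · calc _ ≤ ∑ i ∈ Finset.range n, (1 : ℝ) := Finset.sum_le_sum fun i _ => by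
                rw [Finset.sum_ite_eq]
                split_ifs <;> norm_num
            _ = n := by simp
        · rw [Finset.sum_comm]
          calc _ ≤ ∑ i ∈ Finset.range m, (1 : ℝ) := Finset.sum_le_sum fun i _ => by
                rw [Finset.sum_ite_eq']
                split_ifs <;> norm_num
            _ = m := by simp
        · calc _ ≤ ∑ i ∈ Finset.range n, (1 : ℝ) := Finset.sum_le_sum fun i _ => by
                rw [Finset.sum_ite_eq']
                split_ifs <;> norm_num
            _ = n := by simp
  have hnm' : (n : ℝ) ≤ m := by exact_mod_cast hnm
  nlinarith

/-- In the expanded square the three moments, with coefficients `1`, `-2`, `1`, are all within `3 /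
n` of the same constant. The constant cancels and `4 * (3 / n)` remains. -/
theorem integral_sq_proportion_sub_le [IsProbabilityMeasure ρ] (hρ : Exchangeable ρ) (a : ℕ)
    {n m : ℕ} (hn : 0 < n) (hnm : n ≤ m) :
    ∫ π, (proportion (π.block a) n - proportion (π.block a) m) ^ 2 ∂ρ ≤ 12 / n := by
  have hint : ∀ i j, Integrable
      (fun π : TypedPartition k ℕ => proportion (π.block a) i * proportion (π.block a) j) ρ :=
    fun i j => integrable_of_bounds
      ((measurable_proportion_block a i).mul (measurable_proportion_block a j))
      (fun π => mul_nonneg (proportion_nonneg _ _) (proportion_nonneg _ _))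
      (fun π => mul_le_one₀ (proportion_le_one _ _) (proportion_nonneg _ _)
        (proportion_le_one _ _))
  have hexp : ∫ π, (proportion (π.block a) n - proportion (π.block a) m) ^ 2 ∂ρ =
      ∫ π, proportion (π.block a) n * proportion (π.block a) n ∂ρ -
      2 * ∫ π, proportion (π.block a) n * proportion (π.block a) m ∂ρ +
      ∫ π, proportion (π.block a) m * proportion (π.block a) m ∂ρ := by
    rw [← integral_const_mul, ← integral_sub (hint n n) ((hint n m).const_mul 2),
      ← integral_add (f := fun π : TypedPartition k ℕ =>
        proportion (π.block a) n * proportion (π.block a) n -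
          2 * (proportion (π.block a) n * proportion (π.block a) m))
        ((hint n n).sub ((hint n m).const_mul 2)) (hint m m)]
    refine integral_congr_ae (ae_of_all _ fun π => ?_)
    simp only
    ring
  have h1 := abs_le.1 (abs_integral_proportion_mul_sub_le hρ a hn le_rfl)
  have h2 := abs_le.1 (abs_integral_proportion_mul_sub_le hρ a hn hnm)
  have h3 := abs_le.1 (abs_integral_proportion_mul_sub_le hρ a (hn.trans_le hnm) (le_refl m))
  have h4 : (3 : ℝ) / m ≤ 3 / n :=
    div_le_div_of_nonneg_left (by norm_num) (by exact_mod_cast hn) (by exact_mod_cast hnm)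
  have h5 : (12 : ℝ) / n = 4 * (3 / n) := by ring
  rw [hexp, h5]
  linarith [h1.2, h2.1, h3.2]

/-- Under an exchangeable law, the block of `a` almost surely has an asymptotic frequency. -/
theorem ae_hasFrequency_block [IsProbabilityMeasure ρ] (hρ : Exchangeable ρ) (a : ℕ) :
    ∀ᵐ π ∂ρ, HasFrequency (π.block a) := by
  let z : ℕ → TypedPartition k ℕ → ℝ := fun n π =>
    proportion (π.block a) (n ^ 4) - proportion (π.block a) ((n + 1) ^ 4)
  have hzm : ∀ n, Measurable (z n) := fun n =>
    (measurable_proportion_block a _).sub (measurable_proportion_block a _)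
  have hz1 : ∀ n π, |z n π| ≤ 1 := fun n π => abs_sub_le_of_nonneg_of_le
    (proportion_nonneg _ _) (proportion_le_one _ _) (proportion_nonneg _ _) (proportion_le_one _ _)
  have hzsq : ∀ n, Integrable (fun π => z n π ^ 2) ρ := fun n =>
    integrable_of_bounds ((hzm n).pow_const 2) (fun π => sq_nonneg _)
      (fun π => (sq_le_one_iff_abs_le_one _).2 (hz1 n π))
  have hsum : Summable fun n : ℕ => 12 * (1 / (n : ℝ) ^ 2) :=
    (Real.summable_one_div_nat_pow.2 one_lt_two).mul_left 12
  -- Along fourth powers `z n ^ 2` has expectation at most `12 / n ^ 4`, so the weight `n ^ 2` can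
  -- be afforded. It is what yields summability of `|z n|` itself.
  have hae : ∀ᵐ π ∂ρ, Summable fun n : ℕ => (n : ℝ) ^ 2 * z n π ^ 2 := by
    refine ae_summable_of_summable_integral (fun n π => by positivity)
      (fun n => (hzsq n).const_mul _) ?_
    refine Summable.of_nonneg_of_le (fun n => integral_nonneg fun π => by positivity)
      (fun n => ?_) hsum
    rw [integral_const_mul]
    rcases Nat.eq_zero_or_pos n with rfl | hn
    · simp
    have hnR : (0 : ℝ) < n := by exact_mod_cast hn
    have h := integral_sq_proportion_sub_le hρ a (n := n ^ 4) (m := (n + 1) ^ 4) (by positivity)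
      (Nat.pow_le_pow_left n.le_succ 4)
    calc (n : ℝ) ^ 2 * ∫ π, z n π ^ 2 ∂ρ ≤ (n : ℝ) ^ 2 * (12 / ((n ^ 4 : ℕ) : ℝ)) :=
          mul_le_mul_of_nonneg_left h (by positivity)
      _ = 12 * (1 / (n : ℝ) ^ 2) := by
          push_cast
          field_simp
  filter_upwards [hae] with π hπ
  have hz : Summable fun n => |z n π| := by
    rw [← summable_nat_add_iff 1]
    have h2 := (hπ.add (Real.summable_one_div_nat_pow.2 one_lt_two))
    rw [← summable_nat_add_iff 1] at h2
    refine Summable.of_nonneg_of_le (fun n => abs_nonneg _) (fun n => ?_) h2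
    have hn : (0 : ℝ) < ((n + 1 : ℕ) : ℝ) := by positivity
    set w : ℝ := ((n + 1 : ℕ) : ℝ) with hw
    -- This is the inequality `2 * |z| ≤ w ^ 2 * z ^ 2 + 1 / w ^ 2`, with the square completed.
    have e : w ^ 2 * z (n + 1) π ^ 2 + 1 / w ^ 2 - |z (n + 1) π| =
        (w * |z (n + 1) π| - 1 / w) ^ 2 + |z (n + 1) π| := by
      rw [← sq_abs (z (n + 1) π)]
      field_simp
      ring
    nlinarith [sq_nonneg (w * |z (n + 1) π| - 1 / w), abs_nonneg (z (n + 1) π)]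
  have hcauchy : CauchySeq fun n : ℕ => proportion (π.block a) (n ^ 4) :=
    cauchySeq_of_summable_dist (by simpa only [Real.dist_eq] using hz)
  obtain ⟨l, hl⟩ := cauchySeq_tendsto_of_complete hcauchy
  refine ⟨l, ?_⟩
  have hprop : proportion (π.block a) =
      fun n : ℕ => (fun n : ℕ => ∑ i ∈ Finset.range n, link a i π) n / (n : ℝ) :=
    funext fun n => proportion_block π a n
  rw [hprop]
  refine tendsto_div_of_monotone_of_exists_subseq_tendsto_div _ l ?_ fun b hb =>
    ⟨fun n => n ^ 4, tendsto_succ_pow_four_ratio hb, tendsto_pow_atTop (by norm_num), ?_⟩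
  · exact monotone_nat_of_le_succ fun n => by
      rw [Finset.sum_range_succ]
      linarith [link_nonneg a n π]
  · simpa only [proportion_block] using hl

theorem ae_hasFrequencies [IsProbabilityMeasure ρ] (hρ : Exchangeable ρ) :
    ∀ᵐ π ∂ρ, π.HasFrequencies := by
  filter_upwards [ae_all_iff.2 fun a => ae_hasFrequency_block hρ a] with π hπ
  rintro _ ⟨a, rfl⟩
  exact hπ a

end Frequencies

end TypedPartition

/-! ### Means over `[n]` computed block by block -/

/-- If the rows of `p` are sub-probabilities that converge pointwise to `f`, and `g` vanishes at
infinity, then the `p n`-means of `g` converge to its `f`-mean. -/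
theorem tendsto_sum_mul_of_tendsto_zero {p : ℕ → ℕ → ℝ} {f g : ℕ → ℝ} (hp : ∀ n a, 0 ≤ p n a)
    (hp1 : ∀ n, ∑ a ∈ Finset.range n, p n a ≤ 1)
    (hlim : ∀ a, Tendsto (fun n => p n a) atTop (𝓝 (f a))) (hf0 : ∀ a, 0 ≤ f a)
    (hf : Summable f) (hf1 : ∑' a, f a ≤ 1) (hg0 : ∀ a, 0 ≤ g a)
    (hg : Tendsto g atTop (𝓝 0)) (hfg : Summable fun a => f a * g a) :
    Tendsto (fun n => ∑ a ∈ Finset.range n, p n a * g a) atTop (𝓝 (∑' a, f a * g a)) := by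
  rw [Metric.tendsto_atTop]
  intro ε hε
  obtain ⟨N, hN⟩ := eventually_atTop.1 (hg.eventually (gt_mem_nhds (show 0 < ε / 3 by positivity)))
  have hfin : Tendsto (fun n => ∑ a ∈ Finset.range N, p n a * g a) atTop
      (𝓝 (∑ a ∈ Finset.range N, f a * g a)) :=
    tendsto_finsetSum _ fun a _ => (hlim a).mul_const _
  obtain ⟨N', hN'⟩ := Metric.tendsto_atTop.1 hfin (ε / 3) (by positivity)
  refine ⟨max N N', fun n hn => ?_⟩
  have hnN : N ≤ n := (le_max_left _ _).trans hn
  have h1 := hN' n ((le_max_right _ _).trans hn)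
  have h2 : ∑ a ∈ Finset.range n, p n a * g a =
      ∑ a ∈ Finset.range N, p n a * g a + ∑ a ∈ Finset.Ico N n, p n a * g a :=
    (Finset.sum_range_add_sum_Ico _ hnN).symm
  -- The rows may lose mass at infinity, as they do in the presence of dust, but `g` is small there.
  have h3 : ∑ a ∈ Finset.Ico N n, p n a * g a ≤ ε / 3 := by
    calc _ ≤ ∑ a ∈ Finset.Ico N n, p n a * (ε / 3) := Finset.sum_le_sum fun a ha =>
          mul_le_mul_of_nonneg_left (hN a (Finset.mem_Ico.1 ha).1).le (hp n a)
      _ = (∑ a ∈ Finset.Ico N n, p n a) * (ε / 3) := by rw [Finset.sum_mul]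
      _ ≤ 1 * (ε / 3) := by
          refine mul_le_mul_of_nonneg_right (le_trans ?_ (hp1 n)) (by positivity)
          exact Finset.sum_le_sum_of_subset_of_nonneg
            (fun a ha => Finset.mem_range.2 (Finset.mem_Ico.1 ha).2) fun a _ _ => hp n a
      _ = ε / 3 := one_mul _
  have h3' : 0 ≤ ∑ a ∈ Finset.Ico N n, p n a * g a :=
    Finset.sum_nonneg fun a _ => mul_nonneg (hp n a) (hg0 a)
  have h4 := hfg.sum_add_tsum_nat_add N
  have hsN : Summable fun a => f (a + N) := (summable_nat_add_iff N).2 hf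
  have h5 : ∑' a, f (a + N) * g (a + N) ≤ ε / 3 := by
    calc _ ≤ ∑' a, f (a + N) * (ε / 3) :=
          ((summable_nat_add_iff N).2 hfg).tsum_le_tsum (fun a =>
            mul_le_mul_of_nonneg_left (hN _ (Nat.le_add_left _ _)).le (hf0 _))
            (hsN.mul_right _)
      _ = (∑' a, f (a + N)) * (ε / 3) := tsum_mul_right
      _ ≤ 1 * (ε / 3) := by
          refine mul_le_mul_of_nonneg_right (le_trans ?_ hf1) (by positivity)
          rw [← hf.sum_add_tsum_nat_add N]
          exact le_add_of_nonneg_left (Finset.sum_nonneg fun a _ => hf0 a)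
      _ = ε / 3 := one_mul _
  have h5' : 0 ≤ ∑' a, f (a + N) * g (a + N) := tsum_nonneg fun a => mul_nonneg (hf0 _) (hg0 _)
  rw [Real.dist_eq, abs_lt] at h1 ⊢
  rw [h2, ← h4]
  constructor <;> linarith [h1.1, h1.2]

theorem eventually_sum_range_perm {σ : Equiv.Perm ℕ} (hσ : {n | σ n ≠ n}.Finite) :
    ∀ᶠ n in atTop, ∀ h : ℕ → ℝ,
      ∑ i ∈ Finset.range n, h (σ i) = ∑ i ∈ Finset.range n, h i := by
  obtain ⟨M, hM⟩ := hσ.bddAbove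
  filter_upwards [eventually_gt_atTop M] with n hn h
  exact Equiv.Perm.sum_comp σ _ h fun i hi =>
    Finset.mem_coe.2 (Finset.mem_range.2 ((hM hi).trans_lt hn))

namespace TypedPartition

variable {k : ℕ}

/-- The asymptotic frequency of the block of `a` (its upper frequency in general). -/
def freq (π : TypedPartition k ℕ) (a : ℕ) : ℝ := limsup (proportion (π.block a)) atTop

theorem measurable_freq (a : ℕ) : Measurable fun π : TypedPartition k ℕ => π.freq a :=
  Measurable.limsup fun n => measurable_proportion_block a n

theorem isBoundedUnder_proportion (B : Set ℕ) :
    IsBoundedUnder (· ≤ ·) atTop (proportion B) :=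
  isBoundedUnder_of ⟨1, proportion_le_one B⟩

theorem isCoboundedUnder_proportion (B : Set ℕ) :
    IsCoboundedUnder (· ≤ ·) atTop (proportion B) :=
  (isBoundedUnder_of ⟨0, proportion_nonneg B⟩ :
    IsBoundedUnder (· ≥ ·) atTop (proportion B)).isCoboundedUnder_le

theorem freq_nonneg (π : TypedPartition k ℕ) (a : ℕ) : 0 ≤ π.freq a :=
  le_limsup_of_frequently_le (Frequently.of_forall fun n => proportion_nonneg _ n)
    (isBoundedUnder_proportion _)

theorem freq_le_one (π : TypedPartition k ℕ) (a : ℕ) : π.freq a ≤ 1 :=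
  limsup_le_of_le (isCoboundedUnder_proportion _)
    (Eventually.of_forall fun n => proportion_le_one _ n)

theorem HasFrequencies.tendsto_proportion {π : TypedPartition k ℕ} (h : π.HasFrequencies) (a : ℕ) :
    Tendsto (proportion (π.block a)) atTop (𝓝 (π.freq a)) := by
  obtain ⟨f, hf⟩ := h _ ⟨a, rfl⟩
  rwa [freq, hf.limsup_eq]

theorem HasFrequencies.frequency_block {π : TypedPartition k ℕ} (h : π.HasFrequencies) (a : ℕ) :
    frequency (π.block a) = π.freq a :=
  (h.tendsto_proportion a).limUnder_eq

theorem block_eq_of_rel {π : TypedPartition k ℕ} {a b : ℕ} (h : π.rel a b) :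
    π.block a = π.block b := by
  ext c
  exact ⟨fun hc => π.rel.trans' (π.rel.symm' h) hc, fun hc => π.rel.trans' h hc⟩

theorem freq_eq_of_rel {π : TypedPartition k ℕ} {a b : ℕ} (h : π.rel a b) :
    π.freq a = π.freq b := by
  rw [freq, freq, block_eq_of_rel h]

theorem eventually_proportion_permute {σ : Equiv.Perm ℕ} (hσ : {n | σ n ≠ n}.Finite)
    (π : TypedPartition k ℕ) (a : ℕ) :
    proportion ((permute σ π).block a) =ᶠ[atTop] proportion (π.block (σ a)) := by
  filter_upwards [eventually_sum_range_perm hσ] with n hn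
  rw [proportion_block, proportion_block, ← hn fun i => link (σ a) i π]
  rfl

theorem freq_permute {σ : Equiv.Perm ℕ} (hσ : {n | σ n ≠ n}.Finite) (π : TypedPartition k ℕ)
    (a : ℕ) : (permute σ π).freq a = π.freq (σ a) :=
  limsup_congr (eventually_proportion_permute hσ π a)

theorem HasFrequencies.permute {σ : Equiv.Perm ℕ} (hσ : {n | σ n ≠ n}.Finite)
    {π : TypedPartition k ℕ} (h : π.HasFrequencies) : (permute σ π).HasFrequencies := by
  rintro _ ⟨a, rfl⟩
  exact ⟨_, (h.tendsto_proportion (σ a)).congr' (eventually_proportion_permute hσ π a).symm⟩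

theorem freq_eq_zero_of_type_eq_zero {π : TypedPartition k ℕ} {a : ℕ} (h : π.type a = 0) :
    π.freq a = 0 := by
  refine Tendsto.limsup_eq ?_
  refine squeeze_zero (fun n => proportion_nonneg _ n) (fun n => ?_)
    tendsto_one_div_atTop_nhds_zero_nat
  refine div_le_div_of_nonneg_right ?_ (Nat.cast_nonneg n)
  have : (π.block a ∩ Set.Iio n).ncard ≤ ({a} : Set ℕ).ncard :=
    Set.ncard_le_ncard (fun b hb => (π.type_eq_zero_iff a).1 h b hb.1) (Set.finite_singleton a)
  rw [Set.ncard_singleton] at this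
  exact_mod_cast this

/-- `a` is the least element of its block. -/
def IsLeader (π : TypedPartition k ℕ) (a : ℕ) : Prop := ∀ b, π.rel a b → a ≤ b

theorem IsLeader.eq {π : TypedPartition k ℕ} {a b : ℕ} (ha : π.IsLeader a) (hb : π.IsLeader b)
    (h : π.rel a b) : a = b :=
  le_antisymm (ha b h) (hb a (π.rel.symm' h))

theorem exists_isLeader (π : TypedPartition k ℕ) (i : ℕ) :
    ∃ a, π.IsLeader a ∧ π.rel a i ∧ a ≤ i := by
  classical
  have h : ∃ b, π.rel i b := ⟨i, π.rel.refl' i⟩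
  refine ⟨Nat.find h, fun b hb => Nat.find_min' h (π.rel.trans' (Nat.find_spec h) hb),
    π.rel.symm' (Nat.find_spec h), Nat.find_min' h (π.rel.refl' i)⟩

theorem measurableSet_isLeader (a : ℕ) :
    MeasurableSet {π : TypedPartition k ℕ | π.IsLeader a} := by
  have : {π : TypedPartition k ℕ | π.IsLeader a} =
      ⋂ b, ⋂ (_ : ¬ a ≤ b), {π : TypedPartition k ℕ | π.rel a b}ᶜ := by
    ext π
    simp only [IsLeader, Set.mem_ofPred_eq, Set.mem_iInter, Set.mem_compl_iff]
    exact forall_congr' fun b => not_imp_not.symm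
  rw [this]
  exact MeasurableSet.iInter fun b => MeasurableSet.iInter fun _ => (measurableSet_rel a b).compl

open Classical in
/-- The asymptotic frequency of the block of `a` if `a` is its least element, and `0` otherwise. -/
def leaderMass (π : TypedPartition k ℕ) (a : ℕ) : ℝ := if π.IsLeader a then π.freq a else 0

open Classical in
/-- The proportion in `[n]` of the block of `a` if `a` is its least element, and `0` otherwise. -/
def leaderProportion (π : TypedPartition k ℕ) (n a : ℕ) : ℝ :=
  if π.IsLeader a then proportion (π.block a) n else 0

theorem measurable_leaderMass (a : ℕ) : Measurable fun π : TypedPartition k ℕ => π.leaderMass a :=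
  Measurable.ite (measurableSet_isLeader a) (measurable_freq a) measurable_const

theorem leaderMass_nonneg (π : TypedPartition k ℕ) (a : ℕ) : 0 ≤ π.leaderMass a := by
  unfold leaderMass
  split_ifs
  · exact freq_nonneg π a
  · exact le_rfl

theorem leaderProportion_nonneg (π : TypedPartition k ℕ) (n a : ℕ) :
    0 ≤ π.leaderProportion n a := by
  unfold leaderProportion
  split_ifs
  · exact proportion_nonneg _ _
  · exact le_rfl

theorem leaderMass_pos_iff {π : TypedPartition k ℕ} {a : ℕ} :
    0 < π.leaderMass a ↔ π.IsLeader a ∧ 0 < π.freq a := by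
  unfold leaderMass
  split_ifs with h <;> simp [h]

theorem type_ne_zero_of_leaderMass_pos {π : TypedPartition k ℕ} {a : ℕ}
    (h : 0 < π.leaderMass a) : π.type a ≠ 0 := fun h0 =>
  (leaderMass_pos_iff.1 h).2.ne' (freq_eq_zero_of_type_eq_zero h0)

theorem HasFrequencies.tendsto_leaderProportion {π : TypedPartition k ℕ} (h : π.HasFrequencies)
    (a : ℕ) : Tendsto (fun n => π.leaderProportion n a) atTop (𝓝 (π.leaderMass a)) := by
  unfold leaderProportion leaderMass
  split_ifs
  · exact h.tendsto_proportion a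
  · exact tendsto_const_nhds

open Classical in
/-- The mean over `[n]` of a function that is constant on blocks, computed block by block. -/
theorem sum_div_eq_sum_leaderProportion (π : TypedPartition k ℕ) {g : ℕ → ℝ}
    (hg : ∀ a b, π.rel a b → g a = g b) (n : ℕ) :
    (∑ i ∈ Finset.range n, g i) / n =
      ∑ a ∈ Finset.range n, π.leaderProportion n a * g a := by
  -- The least element of the block of `i` is at most `i`, so the leaders below `n` suffice.
  have h1 : ∀ i ∈ Finset.range n, g i =
      ∑ a ∈ Finset.range n, if π.IsLeader a then link a i π * g a else 0 := by
    intro i hi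
    obtain ⟨a, hl, hr, hle⟩ := π.exists_isLeader i
    rw [Finset.sum_eq_single_of_mem a (Finset.mem_range.2 (hle.trans_lt (Finset.mem_range.1 hi)))]
    · rw [if_pos hl, link, if_pos hr, one_mul, hg a i hr]
    · intro b _ hba
      split_ifs with hb
      · rw [link, if_neg, zero_mul]
        exact fun hbi => hba (hb.eq hl (π.rel.trans' hbi (π.rel.symm' hr)))
      · rfl
  rw [Finset.sum_congr rfl h1, Finset.sum_comm, Finset.sum_div]
  refine Finset.sum_congr rfl fun a _ => ?_
  unfold leaderProportion
  split_ifs with h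
  · rw [← Finset.sum_mul, proportion_block]
    ring
  · simp

theorem sum_leaderProportion_le_one (π : TypedPartition k ℕ) (n : ℕ) :
    ∑ a ∈ Finset.range n, π.leaderProportion n a ≤ 1 := by
  have := π.sum_div_eq_sum_leaderProportion (g := fun _ => 1) (fun _ _ _ => rfl) n
  simp only [mul_one] at this
  rw [← this]
  simp only [Finset.sum_const, Finset.card_range, nsmul_eq_mul, mul_one]
  exact div_self_le_one _

theorem HasFrequencies.sum_leaderMass_le_one {π : TypedPartition k ℕ} (h : π.HasFrequencies)
    (N : ℕ) : ∑ a ∈ Finset.range N, π.leaderMass a ≤ 1 := by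
  refine le_of_tendsto (tendsto_finsetSum _ fun a _ => h.tendsto_leaderProportion a) ?_
  filter_upwards [eventually_ge_atTop N] with n hn
  exact (Finset.sum_le_sum_of_subset_of_nonneg (Finset.range_mono hn)
    fun a _ _ => leaderProportion_nonneg π n a).trans (π.sum_leaderProportion_le_one n)

theorem HasFrequencies.summable_leaderMass {π : TypedPartition k ℕ} (h : π.HasFrequencies) :
    Summable π.leaderMass :=
  summable_of_sum_range_le π.leaderMass_nonneg h.sum_leaderMass_le_one

theorem HasFrequencies.tsum_leaderMass_le_one {π : TypedPartition k ℕ} (h : π.HasFrequencies) :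
    ∑' a, π.leaderMass a ≤ 1 :=
  Real.tsum_le_of_sum_range_le π.leaderMass_nonneg h.sum_leaderMass_le_one

/-- Blocks of positive frequency correspond to their least elements. -/
theorem HasFrequencies.exists_leader_equiv {π : TypedPartition k ℕ} (h : π.HasFrequencies) :
    ∃ φ : {a // 0 < π.leaderMass a} ≃ {B : Set ℕ // B ∈ π.blocks ∧ 0 < frequency B},
      ∀ a, (φ a).1 = π.block a := by
  refine ⟨Equiv.ofBijective (fun a => ⟨π.block a, ⟨a, rfl⟩, ?_⟩) ⟨?_, ?_⟩, fun a => rfl⟩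
  · rw [h.frequency_block]
    exact (leaderMass_pos_iff.1 a.2).2
  · intro a b hab
    have hab' : π.block a = π.block b := congrArg Subtype.val hab
    have hr : π.rel a b := by
      have : (b : ℕ) ∈ π.block b := π.rel.refl' _
      rwa [← hab'] at this
    exact Subtype.ext ((leaderMass_pos_iff.1 a.2).1.eq (leaderMass_pos_iff.1 b.2).1 hr)
  · rintro ⟨_, ⟨i, rfl⟩, hpos⟩
    obtain ⟨a, hl, hr, -⟩ := π.exists_isLeader i
    rw [h.frequency_block, ← freq_eq_of_rel hr] at hpos
    exact ⟨⟨a, leaderMass_pos_iff.2 ⟨hl, hpos⟩⟩, Subtype.ext (block_eq_of_rel hr)⟩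

theorem leaderMass_eq_freq {π : TypedPartition k ℕ} {a : ℕ} (h : 0 < π.leaderMass a) :
    π.leaderMass a = π.freq a :=
  if_pos (leaderMass_pos_iff.1 h).1

/-- Labelling blocks by their least elements replaces a family indexed by sets with one indexed by
integers, each entry of which is measurable in `π`. -/
theorem HasFrequencies.isRanking_iff {π : TypedPartition k ℕ} (h : π.HasFrequencies)
    {x : MassPartition k} : π.IsRanking x ↔ Ranks π.leaderMass π.type x := by
  obtain ⟨φ, hφ⟩ := h.exists_leader_equiv
  constructor
  · rintro ⟨e, he⟩
    refine ⟨φ.trans e, fun a => ⟨?_, ?_⟩⟩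
    · rw [Equiv.trans_apply, (he _).1, hφ, h.frequency_block, leaderMass_eq_freq a.2]
    · rw [Equiv.trans_apply, (he _).2 a (by rw [hφ]; exact π.rel.refl' _)]
  · rintro ⟨e, he⟩
    refine ⟨φ.symm.trans e, fun B => ?_⟩
    obtain ⟨a, rfl⟩ := φ.surjective B
    rw [Equiv.trans_apply, φ.symm_apply_apply, (he a).1, (he a).2, hφ, h.frequency_block,
      leaderMass_eq_freq a.2]
    exact ⟨rfl, fun b hb => π.type_congr _ _ hb⟩

theorem HasFrequencies.isRanking_ranked {π : TypedPartition k ℕ} (h : π.HasFrequencies) :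
    π.IsRanking π.ranked := by
  have hex : ∃ x, π.IsRanking x := by
    obtain ⟨x, hx⟩ := exists_ranks π.leaderMass_nonneg h.summable_leaderMass
      h.tsum_leaderMass_le_one (t := π.type) fun _ => type_ne_zero_of_leaderMass_pos
    exact ⟨x, h.isRanking_iff.2 hx⟩
  rw [ranked, dif_pos ⟨h, hex⟩]
  exact hex.choose_spec

theorem HasFrequencies.ranks_ranked {π : TypedPartition k ℕ} (h : π.HasFrequencies) :
    Ranks π.leaderMass π.type π.ranked :=
  h.isRanking_iff.1 h.isRanking_ranked

open Classical in
/-- The indicator that `a` has type `t`, times a power of the frequency of its block. -/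
def typedFreqPow (m : ℕ) (t : Fin (k + 1)) (a : ℕ) (π : TypedPartition k ℕ) : ℝ :=
  if π.type a = t then π.freq a ^ m else 0

theorem measurable_typedFreqPow (m : ℕ) (t : Fin (k + 1)) (a : ℕ) :
    Measurable (typedFreqPow m t a) :=
  Measurable.ite (measurableSet_type_eq a t) ((measurable_freq a).pow_const m) measurable_const

theorem typedFreqPow_nonneg (m : ℕ) (t : Fin (k + 1)) (a : ℕ) (π : TypedPartition k ℕ) :
    0 ≤ typedFreqPow m t a π := by
  unfold typedFreqPow
  split_ifs
  · exact pow_nonneg (freq_nonneg π a) m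
  · exact le_rfl

theorem typedFreqPow_le_one (m : ℕ) (t : Fin (k + 1)) (a : ℕ) (π : TypedPartition k ℕ) :
    typedFreqPow m t a π ≤ 1 := by
  unfold typedFreqPow
  split_ifs
  · exact pow_le_one₀ (freq_nonneg π a) (freq_le_one π a)
  · exact zero_le_one

theorem typedFreqPow_permute {σ : Equiv.Perm ℕ} (hσ : {n | σ n ≠ n}.Finite) (m : ℕ)
    (t : Fin (k + 1)) (a : ℕ) (π : TypedPartition k ℕ) :
    typedFreqPow m t a (permute σ π) = typedFreqPow m t (σ a) π := by
  unfold typedFreqPow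
  rw [freq_permute hσ]
  rfl

/-- The sum of the `m`-th powers of the frequencies of the blocks of type `t`. -/
def blockPowerSum (m : ℕ) (t : Fin (k + 1)) (π : TypedPartition k ℕ) : ℝ :=
  ∑' a, if π.type a = t then π.leaderMass a ^ m else 0

theorem HasFrequencies.powerSum_ranked {π : TypedPartition k ℕ} (h : π.HasFrequencies) {m : ℕ}
    (hm : m ≠ 0) (t : Fin (k + 1)) : π.ranked.powerSum m t = blockPowerSum m t π :=
  h.ranks_ranked.tsum_eq π.leaderMass_nonneg
    (g := fun a s => if s = t then a ^ m else 0) fun s => by simp [hm]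

/-- The summand is constant on blocks, so the mean weights each block by its proportion in `[n]`. In
the limit this weight is one more factor of the frequency, hence the exponent `m + 1`. -/
theorem HasFrequencies.tendsto_mean_typedFreqPow {π : TypedPartition k ℕ} (h : π.HasFrequencies)
    {m : ℕ} (hm : m ≠ 0) (t : Fin (k + 1)) :
    Tendsto (fun n : ℕ => (∑ i ∈ Finset.range n, typedFreqPow m t i π) / (n : ℝ)) atTop
      (𝓝 (blockPowerSum (m + 1) t π)) := by
  classical
  have hconst : ∀ a b, π.rel a b → typedFreqPow m t a π = typedFreqPow m t b π := by
    intro a b hab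
    unfold typedFreqPow
    rw [freq_eq_of_rel hab, π.type_congr a b hab]
  -- `typedFreqPow` need not tend to `0` in `a`, as it is constant on a large block. Only leaders
  -- carry weight, and restricted to them it does tend to `0`, because `m ≠ 0`.
  let g : ℕ → ℝ := fun a => if π.type a = t then π.leaderMass a ^ m else 0
  have hg : ∀ n a, π.leaderProportion n a * typedFreqPow m t a π =
      π.leaderProportion n a * g a := by
    intro n a
    simp only [leaderProportion, typedFreqPow, g, leaderMass]
    split_ifs <;> simp
  simp_rw [sum_div_eq_sum_leaderProportion π hconst, hg]
  have hfg : (fun a => π.leaderMass a * g a) =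
      fun a => if π.type a = t then π.leaderMass a ^ (m + 1) else 0 := by
    funext a
    simp only [g]
    split_ifs
    · ring
    · simp
  have hle1 : ∀ a, π.leaderMass a ≤ 1 := fun a =>
    (h.summable_leaderMass.le_tsum a fun b _ => π.leaderMass_nonneg b).trans
      h.tsum_leaderMass_le_one
  have hg0 : ∀ a, 0 ≤ g a := by
    intro a
    simp only [g]
    split_ifs
    · exact pow_nonneg (leaderMass_nonneg π a) m
    · exact le_rfl
  have hgle : ∀ a, g a ≤ π.leaderMass a := by
    intro a
    simp only [g]
    split_ifs
    · exact pow_le_of_le_one (leaderMass_nonneg π a) (hle1 a) hm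
    · exact leaderMass_nonneg π a
  rw [blockPowerSum, ← hfg]
  refine tendsto_sum_mul_of_tendsto_zero (fun n a => leaderProportion_nonneg π n a)
    (fun n => sum_leaderProportion_le_one π n) (fun a => h.tendsto_leaderProportion a)
    π.leaderMass_nonneg h.summable_leaderMass h.tsum_leaderMass_le_one hg0 ?_ ?_
  · exact squeeze_zero hg0 hgle h.summable_leaderMass.tendsto_atTop_zero
  · refine Summable.of_nonneg_of_le (fun a => mul_nonneg (leaderMass_nonneg π a) (hg0 a))
      (fun a => ?_) h.summable_leaderMass
    exact mul_le_of_le_one_right (leaderMass_nonneg π a) ((hgle a).trans (hle1 a))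

/-- A permutation changes the leaders, so the invariance is not visible on the series. It is on the
limit of means, since a finite permutation eventually only rearranges `[n]`. -/
theorem HasFrequencies.blockPowerSum_permute {σ : Equiv.Perm ℕ} (hσ : {n | σ n ≠ n}.Finite)
    {π : TypedPartition k ℕ} (h : π.HasFrequencies) {m : ℕ} (hm : m ≠ 0) (t : Fin (k + 1)) :
    blockPowerSum (m + 1) t (TypedPartition.permute σ π) = blockPowerSum (m + 1) t π := by
  refine tendsto_nhds_unique ((h.permute hσ).tendsto_mean_typedFreqPow hm t)
    ((h.tendsto_mean_typedFreqPow hm t).congr' ?_)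
  filter_upwards [eventually_sum_range_perm hσ] with n hn
  simp_rw [typedFreqPow_permute hσ]
  rw [hn fun i => typedFreqPow m t i π]

theorem HasFrequencies.blockPowerSum_mem {π : TypedPartition k ℕ} (h : π.HasFrequencies) {m : ℕ}
    (hm : m ≠ 0) (t : Fin (k + 1)) :
    0 ≤ blockPowerSum (m + 1) t π ∧ blockPowerSum (m + 1) t π ≤ 1 := by
  have hlim := h.tendsto_mean_typedFreqPow hm t
  refine ⟨ge_of_tendsto' hlim fun n => div_nonneg
    (Finset.sum_nonneg fun i _ => typedFreqPow_nonneg m t i π) (Nat.cast_nonneg n),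
    le_of_tendsto' hlim fun n => div_le_one_of_le₀ ?_ (Nat.cast_nonneg n)⟩
  calc _ ≤ ∑ i ∈ Finset.range n, (1 : ℝ) :=
        Finset.sum_le_sum fun i _ => typedFreqPow_le_one m t i π
    _ = n := by simp

theorem measurable_blockPowerSum (m : ℕ) (t : Fin (k + 1)) :
    Measurable (blockPowerSum m t : TypedPartition k ℕ → ℝ) :=
  Measurable.tsum fun a => Measurable.ite (measurableSet_type_eq a t)
    ((measurable_leaderMass a).pow_const m) measurable_const

end TypedPartition

theorem Ranks.congr_type {k : ℕ} {m : ℕ → ℝ} {t t' : ℕ → Fin (k + 1)} {x : MassPartition k}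
    (h : Ranks m t x) (ht : ∀ i, 0 < m i → t i = t' i) : Ranks m t' x := by
  obtain ⟨e, he⟩ := h
  exact ⟨e, fun i => ⟨(he i).1, (he i).2.trans (ht i i.2)⟩⟩

/-! ### Replacement of factors by limits of means -/

namespace TypedPartition

variable {k : ℕ} {ρ : Measure (TypedPartition k ℕ)}

/-- A bounded measurable function, almost surely invariant under the finite permutations that
fix `D`. -/
structure IsInvariantFixing (ρ : Measure (TypedPartition k ℕ)) (D : Finset ℕ)
    (Z : TypedPartition k ℕ → ℝ) : Prop where
  measurable : Measurable Z
  abs_le_one : ∀ᵐ π ∂ρ, |Z π| ≤ 1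
  invariant : ∀ σ : Equiv.Perm ℕ, {n | σ n ≠ n}.Finite → (∀ d ∈ D, σ d = d) →
    ∀ᵐ π ∂ρ, Z (permute σ π) = Z π

namespace IsInvariantFixing

variable {D : Finset ℕ} {Z W : TypedPartition k ℕ → ℝ}

theorem mul (hZ : IsInvariantFixing ρ D Z) (hW : IsInvariantFixing ρ D W) :
    IsInvariantFixing ρ D fun π => Z π * W π where
  measurable := hZ.measurable.mul hW.measurable
  abs_le_one := by
    filter_upwards [hZ.abs_le_one, hW.abs_le_one] with π h1 h2
    rw [abs_mul]
    exact mul_le_one₀ h1 (abs_nonneg _) h2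
  invariant := fun σ hσ hD => by
    filter_upwards [hZ.invariant σ hσ hD, hW.invariant σ hσ hD] with π h1 h2
    rw [h1, h2]

theorem mono {D' : Finset ℕ} (hZ : IsInvariantFixing ρ D Z) (h : D ⊆ D') :
    IsInvariantFixing ρ D' Z :=
  ⟨hZ.measurable, hZ.abs_le_one, fun σ hσ hD => hZ.invariant σ hσ fun d hd => hD d (h hd)⟩

theorem one : IsInvariantFixing ρ D fun _ => 1 :=
  ⟨measurable_const, by simp, fun _ _ _ => by simp⟩

theorem prod {α : Type*} {J : Finset α} {W : α → TypedPartition k ℕ → ℝ}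
    (h : ∀ A ∈ J, IsInvariantFixing ρ D (W A)) :
    IsInvariantFixing ρ D fun π => ∏ A ∈ J, W A π := by
  classical
  induction J using Finset.induction_on with
  | empty => simpa using one
  | insert A J hA ih =>
    simp_rw [Finset.prod_insert hA]
    exact (h A (Finset.mem_insert_self _ _)).mul
      (ih fun B hB => h B (Finset.mem_insert_of_mem hB))

theorem pow (hZ : IsInvariantFixing ρ D Z) (n : ℕ) : IsInvariantFixing ρ D fun π => Z π ^ n := by
  have := prod (J := Finset.range n) (W := fun _ => Z) fun _ _ => hZ
  simpa using this

theorem link {a b : ℕ} (ha : a ∈ D) (hb : b ∈ D) : IsInvariantFixing ρ D (link a b) where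
  measurable := measurable_link a b
  abs_le_one := ae_of_all _ fun π => by
    rw [abs_of_nonneg (link_nonneg a b π)]
    exact link_le_one a b π
  invariant := fun σ _ hD => ae_of_all _ fun π => by rw [link_permute, hD a ha, hD b hb]

theorem freq {a : ℕ} (ha : a ∈ D) : IsInvariantFixing ρ D fun π => π.freq a where
  measurable := measurable_freq a
  abs_le_one := ae_of_all _ fun π => by
    rw [abs_of_nonneg (freq_nonneg π a)]
    exact freq_le_one π a
  invariant := fun σ hσ hD => ae_of_all _ fun π => by rw [freq_permute hσ, hD a ha]

theorem indicator_type_eq {a : ℕ} (ha : a ∈ D) (t : Fin (k + 1)) :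
    IsInvariantFixing ρ D fun π => if π.type a = t then 1 else 0 where
  measurable := Measurable.ite (measurableSet_type_eq a t) measurable_const measurable_const
  abs_le_one := ae_of_all _ fun π => by split_ifs <;> simp
  invariant := fun σ _ hD => ae_of_all _ fun π => by
    have : (permute σ π).type a = π.type (σ a) := rfl
    rw [this, hD a ha]

theorem indicator_sameBlock {A : Finset ℕ} (hA : A ⊆ D) (t : Fin (k + 1)) :
    IsInvariantFixing ρ D ((sameBlock A t).indicator fun _ => 1) where
  measurable := measurable_const.indicator (measurableSet_sameBlock A t)
  abs_le_one := ae_of_all _ fun π => by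
    unfold Set.indicator
    split_ifs <;> simp
  invariant := fun σ _ hD => ae_of_all _ fun π => by
    have : permute σ π ∈ sameBlock A t ↔ π ∈ sameBlock A t := by
      refine forall₂_congr fun a ha => ?_
      have h1 : (permute σ π).type a = π.type (σ a) := rfl
      rw [h1, hD a (hA ha)]
      refine and_congr_right fun _ => forall₂_congr fun b hb => ?_
      have h2 : (permute σ π).rel a b ↔ π.rel (σ a) (σ b) := Iff.rfl
      rw [h2, hD a (hA ha), hD b (hA hb)]
    by_cases h : π ∈ sameBlock A t
    · rw [Set.indicator_of_mem h, Set.indicator_of_mem (this.2 h)]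
    · rw [Set.indicator_of_notMem h, Set.indicator_of_notMem fun h' => h (this.1 h')]

theorem blockPowerSum [IsProbabilityMeasure ρ] (hρ : Exchangeable ρ) {m : ℕ} (hm : 2 ≤ m)
    (t : Fin (k + 1)) : IsInvariantFixing ρ D (blockPowerSum m t) := by
  obtain ⟨m, rfl⟩ : ∃ l, m = l + 1 := ⟨m - 1, by omega⟩
  have hm0 : m ≠ 0 := by omega
  refine ⟨measurable_blockPowerSum _ t, ?_, fun σ hσ _ => ?_⟩
  · filter_upwards [ae_hasFrequencies hρ] with π hπ
    have := hπ.blockPowerSum_mem hm0 t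
    rw [abs_of_nonneg this.1]
    exact this.2
  · filter_upwards [ae_hasFrequencies hρ] with π hπ
    exact hπ.blockPowerSum_permute hσ hm0 t

/-- A factor `X a` may be replaced by the limit of the means of the `X i`. -/
theorem integral_mul_eq_of_tendsto_mean [IsProbabilityMeasure ρ] (hρ : Exchangeable ρ)
    (hZ : IsInvariantFixing ρ D Z) {a : ℕ} (ha : a ∉ D) {X : ℕ → TypedPartition k ℕ → ℝ}
    {Y : TypedPartition k ℕ → ℝ} (hXm : ∀ i, Measurable (X i)) (hX0 : ∀ i π, 0 ≤ X i π)
    (hX1 : ∀ i π, X i π ≤ 1)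
    (hperm : ∀ b ∉ D, ∀ π, X a (permute (Equiv.swap a b) π) = X b π)
    (hlim : ∀ᵐ π ∂ρ, Tendsto (fun n : ℕ => (∑ i ∈ Finset.range n, X i π) / (n : ℝ)) atTop
      (𝓝 (Y π))) :
    ∫ π, Z π * X a π ∂ρ = ∫ π, Z π * Y π ∂ρ := by
  have hXabs : ∀ i π, |X i π| ≤ 1 := fun i π => by
    rw [abs_of_nonneg (hX0 i π)]
    exact hX1 i π
  have hint : ∀ i, Integrable (fun π => Z π * X i π) ρ := fun i =>
    Integrable.of_bound (hZ.measurable.mul (hXm i)).aestronglyMeasurable 1 (by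
      filter_upwards [hZ.abs_le_one] with π hπ
      rw [Real.norm_eq_abs, abs_mul]
      exact mul_le_one₀ hπ (abs_nonneg _) (hXabs i π))
  -- The transposition of `a` and `b` fixes `D`, hence `Z`, and carries `X a` to `X b`. The finitely
  -- many indices in `D` are negligible in the means.
  have hconst : ∀ b ∉ D, ∫ π, Z π * X b π ∂ρ = ∫ π, Z π * X a π ∂ρ := by
    intro b hb
    rw [← hρ.integral_permute (finite_swap_ne a b) (f := fun π => Z π * X a π)
      (hZ.measurable.mul (hXm a))]
    refine integral_congr_ae ?_
    filter_upwards [hZ.invariant (Equiv.swap a b) (finite_swap_ne a b) fun d hd =>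
      Equiv.swap_apply_of_ne_of_ne (fun h => ha (h ▸ hd)) (fun h => hb (h ▸ hd))] with π hπ
    rw [hπ, hperm b hb]
  have hces : Tendsto (fun n : ℕ => (n : ℝ)⁻¹ *
      ∑ i ∈ Finset.range n, ∫ π, Z π * X i π ∂ρ) atTop (𝓝 (∫ π, Z π * X a π ∂ρ)) := by
    refine Filter.Tendsto.cesaro (tendsto_const_nhds.congr' ?_)
    obtain ⟨M, hM⟩ := D.finite_toSet.bddAbove
    filter_upwards [eventually_gt_atTop M] with i hi
    exact (hconst i fun h => absurd (hM (Finset.mem_coe.2 h)) (not_le.2 hi)).symm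
  have hdom : Tendsto (fun n : ℕ => ∫ π, Z π * ((∑ i ∈ Finset.range n, X i π) / (n : ℝ)) ∂ρ) atTop
      (𝓝 (∫ π, Z π * Y π ∂ρ)) := by
    refine tendsto_integral_of_dominated_convergence (fun _ => 1) (fun n => ?_)
      (integrable_const _) (fun n => ?_) ?_
    · exact (hZ.measurable.mul ((Finset.measurable_fun_sum _ fun i _ => hXm i).div_const
        _)).aestronglyMeasurable
    · filter_upwards [hZ.abs_le_one] with π hπ
      rw [Real.norm_eq_abs, abs_mul]
      refine mul_le_one₀ hπ (abs_nonneg _) ?_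
      rw [abs_of_nonneg (div_nonneg (Finset.sum_nonneg fun i _ => hX0 i π) (Nat.cast_nonneg n))]
      refine div_le_one_of_le₀ ?_ (Nat.cast_nonneg n)
      calc _ ≤ ∑ i ∈ Finset.range n, (1 : ℝ) := Finset.sum_le_sum fun i _ => hX1 i π
        _ = n := by simp
    · filter_upwards [hlim] with π hπ using hπ.const_mul _
  refine tendsto_nhds_unique hces (hdom.congr fun n => ?_)
  rw [← integral_finsetSum _ fun i _ => hint i, ← integral_const_mul]
  refine integral_congr_ae (ae_of_all _ fun π => ?_)
  simp only [← Finset.mul_sum]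
  ring

theorem integral_mul_prod_link [IsProbabilityMeasure ρ] (hρ : Exchangeable ρ)
    (hZ : IsInvariantFixing ρ D Z) {r : ℕ} (hr : r ∈ D) {A : Finset ℕ} (hA : ∀ a ∈ A, a ∉ D) :
    ∫ π, Z π * ∏ a ∈ A, TypedPartition.link r a π ∂ρ = ∫ π, Z π * π.freq r ^ A.card ∂ρ := by
  induction A using Finset.induction_on generalizing Z D with
  | empty => simp
  | insert a A haA ih =>
    have haD : a ∉ D := hA a (Finset.mem_insert_self _ _)
    -- The new link is absorbed into `Z`, at the price of fixing `a`, while the other links are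
    -- replaced. It is then replaced in turn, with `Z` times a power of `freq r`, which does not
    -- involve `a`.
    have hZa : IsInvariantFixing ρ (insert a D) fun π => Z π * TypedPartition.link r a π :=
      (hZ.mono (Finset.subset_insert _ _)).mul
        (link (Finset.mem_insert_of_mem hr) (Finset.mem_insert_self _ _))
    have h1 := ih hZa (Finset.mem_insert_of_mem hr) fun b hb => by
      rw [Finset.mem_insert, not_or]
      exact ⟨fun h => haA (h ▸ hb), hA b (Finset.mem_insert_of_mem hb)⟩
    have h2 := integral_mul_eq_of_tendsto_mean hρ (hZ.mul ((freq hr).pow A.card)) haD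
      (X := fun i => TypedPartition.link r i) (Y := fun π => π.freq r) (measurable_link r)
      (link_nonneg r) (link_le_one r) (fun b hb π => by
        have hra : r ≠ a := fun h => haD (h ▸ hr)
        have hrb : r ≠ b := fun h => hb (h ▸ hr)
        rw [link_permute, Equiv.swap_apply_left, Equiv.swap_apply_of_ne_of_ne hra hrb]) (by
        filter_upwards [ae_hasFrequencies hρ] with π hπ
        exact (hπ.tendsto_proportion r).congr fun n => proportion_block π r n)
    simp_rw [Finset.prod_insert haA, ← mul_assoc, Finset.card_insert_of_notMem haA, pow_succ]
    rw [h1]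
    calc _ = ∫ π, Z π * π.freq r ^ A.card * TypedPartition.link r a π ∂ρ := by
          simp_rw [mul_right_comm]
      _ = _ := by
          rw [h2]
          simp_rw [mul_assoc]

/-- With a representative `r` of `A`, the event says that `r` has type `t` and is linked to the
other points. The `|A| - 1` links become powers of `freq r`; averaging over `r` then supplies the
last factor. -/
theorem integral_mul_indicator_sameBlock [IsProbabilityMeasure ρ] (hρ : Exchangeable ρ)
    (hZ : IsInvariantFixing ρ D Z) {A : Finset ℕ} (hA : Disjoint D A) (hcard : 2 ≤ A.card)
    (t : Fin (k + 1)) :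
    ∫ π, Z π * (sameBlock A t).indicator (fun _ => 1) π ∂ρ =
      ∫ π, Z π * TypedPartition.blockPowerSum A.card t π ∂ρ := by
  classical
  obtain ⟨r, hr⟩ : A.Nonempty := Finset.card_pos.1 (by omega)
  have hrD : r ∉ D := Finset.disjoint_right.1 hA hr
  have hc : A.card = (A.erase r).card + 1 := (Finset.card_erase_add_one hr).symm
  have hind : ∀ π : TypedPartition k ℕ, (sameBlock A t).indicator (fun _ => (1 : ℝ)) π =
      (if π.type r = t then 1 else 0) * ∏ a ∈ A.erase r, TypedPartition.link r a π := by
    intro π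
    by_cases h : π ∈ sameBlock A t
    · rw [Set.indicator_of_mem h, if_pos (h r hr).1, one_mul]
      refine (Finset.prod_eq_one fun a ha => ?_).symm
      exact if_pos ((h r hr).2 a (Finset.mem_of_mem_erase ha))
    · rw [Set.indicator_of_notMem h]
      by_cases ht : π.type r = t
      · have : ∃ a ∈ A, ¬ π.rel r a := by
          by_contra hcon
          push Not at hcon
          exact h fun a ha => ⟨(π.type_congr _ _ (hcon a ha)).symm.trans ht, fun b hb =>
            π.rel.trans' (π.rel.symm' (hcon a ha)) (hcon b hb)⟩
        obtain ⟨a, ha, hra⟩ := this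
        rw [Finset.prod_eq_zero (i := a) _ (if_neg hra), mul_zero]
        refine Finset.mem_erase.2 ⟨?_, ha⟩
        rintro rfl
        exact hra (π.rel.refl' _)
      · rw [if_neg ht, zero_mul]
  have hZt : IsInvariantFixing ρ (insert r D) fun π => Z π * if π.type r = t then 1 else 0 :=
    (hZ.mono (Finset.subset_insert _ _)).mul (indicator_type_eq (Finset.mem_insert_self _ _) t)
  have h1 := integral_mul_prod_link hρ hZt (Finset.mem_insert_self r D) (A := A.erase r)
    fun a ha => by
      rw [Finset.mem_insert, not_or]
      exact ⟨Finset.ne_of_mem_erase ha,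
        Finset.disjoint_right.1 hA (Finset.mem_of_mem_erase ha)⟩
  have hm : (A.erase r).card ≠ 0 := by omega
  have h2 := integral_mul_eq_of_tendsto_mean hρ hZ hrD
    (X := typedFreqPow (A.erase r).card t)
    (Y := TypedPartition.blockPowerSum ((A.erase r).card + 1) t)
    (measurable_typedFreqPow _ t) (typedFreqPow_nonneg _ t) (typedFreqPow_le_one _ t)
    (fun b _ π => by rw [typedFreqPow_permute (finite_swap_ne r b), Equiv.swap_apply_left])
    (by
      filter_upwards [ae_hasFrequencies hρ] with π hπ
      exact hπ.tendsto_mean_typedFreqPow hm t)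
  simp_rw [hind, ← mul_assoc]
  rw [h1, hc, ← h2]
  refine integral_congr_ae (ae_of_all _ fun π => ?_)
  simp only [typedFreqPow]
  split_ifs <;> simp

/-- The sets are treated one at a time. Indicators still to be replaced join `Z` with their points
fixed; power sums already obtained are almost surely invariant under all finite permutations. -/
theorem integral_mul_prod_indicator_sameBlock [IsProbabilityMeasure ρ] (hρ : Exchangeable ρ)
    (hZ : IsInvariantFixing ρ D Z) {J : Finset (Finset ℕ)} {θ : Finset ℕ → Fin (k + 1)}
    (hJ : (J : Set (Finset ℕ)).PairwiseDisjoint id) (hcard : ∀ A ∈ J, 2 ≤ A.card)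
    (hD : ∀ A ∈ J, Disjoint D A) :
    ∫ π, Z π * ∏ A ∈ J, (sameBlock A (θ A)).indicator (fun _ => 1) π ∂ρ =
      ∫ π, Z π * ∏ A ∈ J, TypedPartition.blockPowerSum A.card (θ A) π ∂ρ := by
  classical
  induction J using Finset.induction_on generalizing Z D with
  | empty => simp
  | insert A J hA ih =>
    have hZA : IsInvariantFixing ρ (D ∪ A)
        fun π => Z π * (sameBlock A (θ A)).indicator (fun _ => 1) π :=
      (hZ.mono Finset.subset_union_left).mul (indicator_sameBlock Finset.subset_union_right _)
    have h1 := ih hZA (hJ.subset (by simp)) (fun B hB => hcard B (Finset.mem_insert_of_mem hB))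
      fun B hB => by
        rw [Finset.disjoint_union_left]
        refine ⟨hD B (Finset.mem_insert_of_mem hB), ?_⟩
        exact hJ (by simp) (by simp [hB]) (by rintro rfl; exact hA hB)
    have h2 := integral_mul_indicator_sameBlock hρ
      (hZ.mul (prod (J := J) (W := fun B => TypedPartition.blockPowerSum B.card (θ B))
        fun B hB => blockPowerSum hρ (hcard B (Finset.mem_insert_of_mem hB)) _))
      (hD A (Finset.mem_insert_self _ _)) (hcard A (Finset.mem_insert_self _ _)) (θ A)
    simp_rw [Finset.prod_insert hA, ← mul_assoc]
    rw [h1]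
    simp_rw [mul_right_comm (Z _) _ (∏ B ∈ J, TypedPartition.blockPowerSum B.card (θ B) _)]
    rw [h2]

end IsInvariantFixing

theorem Exchangeable.measure_iInter_sameBlock [IsProbabilityMeasure ρ] (hρ : Exchangeable ρ)
    {J : Finset (Finset ℕ)} {θ : Finset ℕ → Fin (k + 1)}
    (hJ : (J : Set (Finset ℕ)).PairwiseDisjoint id) (hcard : ∀ A ∈ J, 2 ≤ A.card) :
    ρ (⋂ A ∈ J, sameBlock A (θ A)) =
      ENNReal.ofReal (∫ π, ∏ A ∈ J, blockPowerSum A.card (θ A) π ∂ρ) := by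
  have h := IsInvariantFixing.integral_mul_prod_indicator_sameBlock hρ
    (IsInvariantFixing.one (D := ∅)) (θ := θ) hJ hcard fun A _ => Finset.disjoint_empty_left _
  simp only [one_mul] at h
  have hind : ∀ π, ∏ A ∈ J, (sameBlock A (θ A)).indicator (fun _ => (1 : ℝ)) π =
      (⋂ A ∈ J, sameBlock A (θ A)).indicator 1 π := by
    intro π
    by_cases hπ : π ∈ ⋂ A ∈ J, sameBlock A (θ A)
    · rw [Set.indicator_of_mem hπ]
      exact Finset.prod_eq_one fun A hA => Set.indicator_of_mem (Set.mem_iInter₂.1 hπ A hA) _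
    · rw [Set.indicator_of_notMem hπ]
      simp only [Set.mem_iInter, not_forall] at hπ
      obtain ⟨A, hA, hn⟩ := hπ
      exact Finset.prod_eq_zero hA (Set.indicator_of_notMem hn _)
  simp_rw [hind] at h
  rw [← h, integral_indicator_one (J.measurableSet_biInter fun A _ => measurableSet_sameBlock A _),
    Measure.real, ENNReal.ofReal_toReal (measure_ne_top _ _)]

/-! ### Measurability of the ranked frequencies and conclusion -/

/-- The masses of the blocks of the `N` first leaders, rounded down to multiples of
`1 / (N + 1)`. -/
def roundedMass (N : ℕ) (π : TypedPartition k ℕ) (a : ℕ) : ℝ :=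
  if a < N then (⌊π.leaderMass a * (N + 1)⌋₊ : ℝ) / (N + 1) else 0

theorem roundedMass_nonneg (N : ℕ) (π : TypedPartition k ℕ) (a : ℕ) : 0 ≤ roundedMass N π a := by
  unfold roundedMass
  split_ifs
  · positivity
  · exact le_rfl

theorem roundedMass_le (N : ℕ) (π : TypedPartition k ℕ) (a : ℕ) :
    roundedMass N π a ≤ π.leaderMass a := by
  unfold roundedMass
  split_ifs
  · rw [div_le_iff₀ (by positivity)]
    exact Nat.floor_le (mul_nonneg (leaderMass_nonneg π a) (by positivity))
  · exact leaderMass_nonneg π a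

theorem tendsto_roundedMass (π : TypedPartition k ℕ) (a : ℕ) :
    Tendsto (fun N => roundedMass N π a) atTop (𝓝 (π.leaderMass a)) := by
  have h : Tendsto (fun N : ℕ => π.leaderMass a - 1 / ((N : ℝ) + 1)) atTop
      (𝓝 (π.leaderMass a - 0)) := tendsto_const_nhds.sub tendsto_one_div_add_atTop_nhds_zero_nat
  rw [sub_zero] at h
  refine tendsto_of_tendsto_of_tendsto_of_le_of_le' h tendsto_const_nhds ?_
    (Eventually.of_forall fun N => roundedMass_le N π a)
  filter_upwards [eventually_gt_atTop a] with N hN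
  have hpos : (0 : ℝ) < N + 1 := by positivity
  rw [roundedMass, if_pos hN, sub_le_iff_le_add, ← add_div, le_div_iff₀ hpos]
  exact (Nat.lt_floor_add_one _).le

/-- The ranked version of the rounded masses. -/
def roundedRanked (N : ℕ) (π : TypedPartition k ℕ) : MassPartition k :=
  rankOf (roundedMass N π) fun a => if a < N then π.type a else 0

/-- Rounding and truncation make the map factor through a countable discrete space, where the choice
of a ranking is automatically measurable. For this reason types beyond `N` are erased. -/
theorem measurable_roundedRanked (N : ℕ) :
    Measurable (roundedRanked N : TypedPartition k ℕ → MassPartition k) := by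
  let code : TypedPartition k ℕ → Fin N → ℕ × Fin (k + 1) := fun π a =>
    (⌊π.leaderMass a * (N + 1)⌋₊, π.type a)
  let decode : (Fin N → ℕ × Fin (k + 1)) → MassPartition k := fun c =>
    rankOf (fun a => if h : a < N then ((c ⟨a, h⟩).1 : ℝ) / (N + 1) else 0)
      fun a => if h : a < N then (c ⟨a, h⟩).2 else 0
  have hcode : Measurable code := measurable_pi_lambda _ fun a =>
    (Nat.measurable_floor.comp ((measurable_leaderMass a).mul_const _)).prodMk (measurable_type a)
  have hdecode : Measurable decode := measurable_of_countable _
  exact hdecode.comp hcode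

/-- Rounding down keeps the total mass at most `1` and provides the dominating family `leaderMass`.
-/
theorem HasFrequencies.tendsto_roundedRanked {π : TypedPartition k ℕ} (h : π.HasFrequencies) :
    Tendsto (fun N => roundedRanked N π) atTop (𝓝 π.ranked) := by
  have hpos : ∀ N a, 0 < roundedMass N π a → a < N := by
    intro N a ha
    by_contra hN
    rw [roundedMass, if_neg hN] at ha
    exact lt_irrefl _ ha
  have hsum : ∀ N, Summable (roundedMass N π) := fun N =>
    Summable.of_nonneg_of_le (roundedMass_nonneg N π) (roundedMass_le N π) h.summable_leaderMass
  refine tendsto_of_ranks (M := fun N => roundedMass N π) (t := π.type) (fun N => ?_)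
    h.ranks_ranked (fun N => roundedMass_nonneg N π) (fun N => roundedMass_le N π)
    h.summable_leaderMass (tendsto_roundedMass π)
  have hr : Ranks (roundedMass N π) (fun a => if a < N then π.type a else 0)
      (roundedRanked N π) := by
    refine ranks_rankOf (roundedMass_nonneg N π) (hsum N) ?_ fun a ha => ?_
    · exact ((hsum N).tsum_le_tsum (roundedMass_le N π) h.summable_leaderMass).trans
        h.tsum_leaderMass_le_one
    · rw [if_pos (hpos N a ha)]
      exact type_ne_zero_of_leaderMass_pos (ha.trans_le (roundedMass_le N π a))
  exact hr.congr_type fun a ha => if_pos (hpos N a ha)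

theorem Exchangeable.aemeasurable_ranked [IsProbabilityMeasure ρ] (hρ : Exchangeable ρ) :
    AEMeasurable ranked ρ :=
  aemeasurable_of_tendsto_metrizable_ae' (fun N => (measurable_roundedRanked N).aemeasurable) <| by
    filter_upwards [ae_hasFrequencies hρ] with π hπ using hπ.tendsto_roundedRanked

/-- An exchangeable law is a mixture of paintboxes, directed by the law of the ranked
frequencies. -/
theorem Exchangeable.eq_bind_paintbox [IsProbabilityMeasure ρ] (hρ : Exchangeable ρ) :
    ρ = (ρ.map ranked).bind paintbox := by
  have hmap : IsProbabilityMeasure (ρ.map ranked) :=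
    Measure.isProbabilityMeasure_map hρ.aemeasurable_ranked
  have hbind := isProbabilityMeasure_bind_paintbox (ρ.map ranked)
  refine ext_of_generate_finite _ (borel_eq_generateFrom_patternEvents k)
    (isPiSystem_patternEvents k) ?_ (by simp)
  rintro _ ⟨s, τ, hs, rfl⟩
  rcases (pattern s τ).eq_empty_or_nonempty with h | h
  · simp [h]
  obtain ⟨J, θ, hJ, hcard, hθ, heq⟩ := exists_pattern_eq_iInter_sameBlock hs h
  rw [heq, hρ.measure_iInter_sameBlock hJ hcard, Measure.bind_apply
    (J.measurableSet_biInter fun A _ => measurableSet_sameBlock A _)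
    (measurable_paintbox k).aemeasurable]
  simp_rw [paintbox_iInter_sameBlock _ hJ hcard hθ]
  have hm : Measurable fun x : MassPartition k => ∏ A ∈ J, x.powerSum A.card (θ A) :=
    (continuous_finsetProd J fun A hA =>
      MassPartition.continuous_powerSum (hcard A hA) (hθ A hA)).measurable
  rw [lintegral_map' hm.ennreal_ofReal.aemeasurable hρ.aemeasurable_ranked]
  have hS : IsInvariantFixing ρ ∅ fun π => ∏ A ∈ J, blockPowerSum A.card (θ A) π :=
    IsInvariantFixing.prod fun A hA => IsInvariantFixing.blockPowerSum hρ (hcard A hA) _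
  -- Both sides of the mixture formula are expectations of the same product, written once on the
  -- ranked sequence and once on the blocks.
  have heq : ∀ᵐ π ∂ρ, ∏ A ∈ J, π.ranked.powerSum A.card (θ A) =
      ∏ A ∈ J, blockPowerSum A.card (θ A) π := by
    filter_upwards [ae_hasFrequencies hρ] with π hπ
    exact Finset.prod_congr rfl fun A hA =>
      hπ.powerSum_ranked (by have := hcard A hA; omega) _
  rw [ofReal_integral_eq_lintegral_ofReal]
  · refine lintegral_congr_ae ?_
    filter_upwards [heq] with π hπ
    rw [hπ]
  · exact Integrable.of_bound hS.measurable.aestronglyMeasurable 1 hS.abs_le_one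
  · filter_upwards [heq] with π hπ
    rw [← hπ]
    exact Finset.prod_nonneg fun A _ => π.ranked.powerSum_nonneg _ _

end TypedPartition

end

theorem theorem1 (k : ℕ) (hk : 1 ≤ k) :
    Measurable (paintbox : MassPartition k → Measure (TypedPartition k ℕ)) ∧
    (∀ ρ : Measure (TypedPartition k ℕ), IsProbabilityMeasure ρ →
      TypedPartition.Exchangeable ρ →
        (∀ᵐ π ∂ρ, π.HasFrequencies ∧ π.IsRanking π.ranked) ∧
        AEMeasurable TypedPartition.ranked ρ ∧
        ρ = (ρ.map TypedPartition.ranked).bind paintbox) ∧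
    (∀ ϱ : Measure (MassPartition k), IsProbabilityMeasure ϱ →
      IsProbabilityMeasure (ϱ.bind paintbox) ∧
        TypedPartition.Exchangeable (ϱ.bind paintbox)) := by
  refine ⟨measurable_paintbox k, fun ρ _ hρ => ⟨?_, hρ.aemeasurable_ranked, hρ.eq_bind_paintbox⟩,
    fun ϱ _ => ⟨isProbabilityMeasure_bind_paintbox ϱ, exchangeable_bind_paintbox ϱ⟩⟩
  filter_upwards [TypedPartition.ae_hasFrequencies hρ] with π hπ
  exact ⟨hπ, hπ.isRanking_ranked⟩
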